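/- Let $\mathrm{Nil}$ be the group of real matrices $\begin{pmatrix}1&x&z\\0&1&y\\0&0&1\end{pmatrix}$ with the left invariant metric $dx^2+dy^2+(dz-x\,dy)^2$, and let $e_1,e_2,e_3$ be the left invariant orthonormal frame dual to $dx,\ dy,\ dz-x\,dy$, taken as positively oriented. Let $f:M\to\mathrm{Nil}$ be a smooth immersion of a closed oriented surface $M$. Equip $M$ with the complex structure determined by the orientation and the induced metric, so that $M$ is a compact Riemann surface and $f$ is a conformal immersion. In a conformal parameter $z$ on $M$ (a holomorphic chart) write $f^{-1}\partial f=\sum_k Z_ke_k$, where $\partial=\partial_z$, $\bar\partial=\partial_{\bar z}$. A generating spinor is a smooth pair $\psi=(\psi_1,\psi_2)$ of local complex functions (determined up to a common sign) with $$Z_1=\tfrac i2(\bar\psi_2^2+\psi_1^2),\qquad Z_2=\tfrac12(\bar\psi_2^2-\psi_1^2),\qquad Z_3=\psi_1\bar\psi_2 .$$ Let $H$ be the mean curvature (half the trace of the second fundamental form $\langle\nabla df,N\rangle$, where $N$ is the unit normal making $(f_x,f_y,N)$ positively oriented for $z=x+iy$). Then locally there are a generating spinor $\psi$ and continuous functions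 $U,V$ (the potentials) for which $\psi$ satisfies the Dirac equation $$\partial\psi_2+U\psi_1=0,\qquad -\bar\partial\psi_1+V\psi_2=0 ,$$ the value of the product $UV$ at each point is independent of the choice of $\psi,U,V$ and so depends only on $f$ and the conformal parameter, and $UV\,\frac{i\,dz\wedge d\bar z}{2}$ is a well-defined continuous 2-form on $M$. The spinor energy $$E(M)=\int_M UV\,\frac{i\,dz\wedge d\bar z}{2}$$ is real and equals $$E(M)=\int_M\left(\frac{H^2}{4}\bigl(|\psi_1|^2+|\psi_2|^2\bigr)^2-\frac1{16}\bigl(|\psi_2|^2-|\psi_1|^2\bigr)^2\right)\frac{i\,dz\wedge d\bar z}{2}.$$ -/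

import Mathlib

open scoped Manifold ContDiff Matrix

noncomputable section

/-- The group Nil: the point `⟨x, y, z⟩` stands for the matrix `[1, x, z; 0, 1, y; 0, 0, 1]`. -/
@[ext]
structure Nil where
  x : ℝ
  y : ℝ
  z : ℝ

namespace Nil

/-- The upper unitriangular matrix of an element of Nil. -/
def toMatrix (g : Nil) : Matrix (Fin 3) (Fin 3) ℝ :=
  !![1, g.x, g.z; 0, 1, g.y; 0, 0, 1]

instance : Mul Nil := ⟨fun g h => ⟨g.x + h.x, g.y + h.y, g.z + g.x * h.y + h.z⟩⟩

instance : One Nil := ⟨⟨0, 0, 0⟩⟩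

instance : Inv Nil := ⟨fun g => ⟨-g.x, -g.y, g.x * g.y - g.z⟩⟩

theorem mul_def (g h : Nil) :
    g * h = ⟨g.x + h.x, g.y + h.y, g.z + g.x * h.y + h.z⟩ := rfl

theorem one_def : (1 : Nil) = ⟨0, 0, 0⟩ := rfl

theorem inv_def (g : Nil) : g⁻¹ = ⟨-g.x, -g.y, g.x * g.y - g.z⟩ := rfl

instance : Group Nil :=
  Group.ofLeftAxioms
    (fun a b c => by ext <;> simp only [mul_def] <;> ring)
    (fun a => by ext <;> simp [mul_def, one_def])
    (fun a => by ext <;> simp only [mul_def, one_def, inv_def] <;> ring)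

/-- The product of Nil is the product of matrices. -/
theorem toMatrix_mul (g h : Nil) : (g * h).toMatrix = g.toMatrix * h.toMatrix := by
  ext i j
  fin_cases i <;> fin_cases j <;>
    simp [toMatrix, mul_def, Matrix.mul_apply, Fin.sum_univ_three] <;> ring

/-- The basis `e₁, e₂, e₃` (indices `0, 1, 2`) of the Lie algebra of Nil. -/
def basis : Fin 3 → Matrix (Fin 3) (Fin 3) ℝ
  | 0 => !![0, 1, 0; 0, 0, 0; 0, 0, 0]
  | 1 => !![0, 0, 0; 0, 0, 1; 0, 0, 0]
  | 2 => !![0, 0, 1; 0, 0, 0; 0, 0, 0]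

/-- The coordinates of a strictly upper triangular matrix in the basis `e₁, e₂, e₃`. -/
def coord (A : Matrix (Fin 3) (Fin 3) ℝ) : Fin 3 → ℝ := ![A 0 1, A 1 2, A 0 2]

/-- The coordinates of the tangent vector `A` at `g` after left translation to the unit. The
left invariant metric makes `e₁, e₂, e₃` orthonormal, so it is the dot product of these
coordinates, see `leftCoord_eq`. -/
def leftCoord (g : Nil) (A : Matrix (Fin 3) (Fin 3) ℝ) : Fin 3 → ℝ :=
  coord (g⁻¹.toMatrix * A)

/-- The left invariant coframe is `dx, dy, dz - x dy`, hence the left invariant metric is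
`dx² + dy² + (dz - x dy)²`. -/
theorem leftCoord_eq (g : Nil) (dx dy dz : ℝ) :
    leftCoord g !![0, dx, dz; 0, 0, dy; 0, 0, 0] = ![dx, dy, dz - g.x * dy] := by
  ext i
  fin_cases i <;>
    simp [leftCoord, coord, toMatrix, inv_def, Matrix.mul_apply, Fin.sum_univ_three] <;> ring

/-- The structure constants `⟨[eᵢ, eⱼ], eₖ⟩`. -/
def structureConst (i j k : Fin 3) : ℝ :=
  coord (basis i * basis j - basis j * basis i) k

/-- The coefficient at `eᵢ` of `∇_{eₖ} eⱼ` for the Levi-Civita connection of the left invariant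
metric (the Koszul formula for a left invariant orthonormal frame). -/
def connection (k j i : Fin 3) : ℝ :=
  (1 / 2) * (structureConst k j i + structureConst i k j + structureConst i j k)

end Nil

/-- `mcForm F w v` is the left translation `F⁻¹ dF(v)` to the Lie algebra, in the basis
`e₁, e₂, e₃`, of the derivative at `w` of `F : ℂ → Nil` in the direction `v`. -/
def mcForm (F : ℂ → Nil) (w v : ℂ) : Fin 3 → ℝ :=
  Nil.leftCoord (F w) (Matrix.of fun i j => fderiv ℝ (fun u => (F u).toMatrix i j) w v)

/-- The first fundamental form `⟨dF(u), dF(v)⟩` at `w`. -/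
def firstForm (F : ℂ → Nil) (w u v : ℂ) : ℝ := mcForm F w u ⬝ᵥ mcForm F w v

/-- The covariant derivative `∇_u (dF(v))` at `w` along `F` (`u`, `v` constant vector fields),
left translated to the Lie algebra. -/
def covDeriv (F : ℂ → Nil) (w u v : ℂ) : Fin 3 → ℝ := fun i =>
  fderiv ℝ (fun t => mcForm F t v i) w u +
    ∑ k, ∑ j, mcForm F w u k * mcForm F w v j * Nil.connection k j i

/-- The unit normal `N`, left translated to the Lie algebra; `(F_x, F_y, N)` is positively
oriented, where `e₁, e₂, e₃` is a positively oriented basis. -/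
def unitNormal (F : ℂ → Nil) (w : ℂ) : Fin 3 → ℝ :=
  let n := crossProduct (mcForm F w 1) (mcForm F w Complex.I)
  (Real.sqrt (n ⬝ᵥ n))⁻¹ • n

/-- The second fundamental form `⟨∇_u dF(v), N⟩`. -/
def secondForm (F : ℂ → Nil) (w u v : ℂ) : ℝ := covDeriv F w u v ⬝ᵥ unitNormal F w

/-- The mean curvature: half the trace of the second fundamental form with respect to the
first one. -/
def meanCurvature (F : ℂ → Nil) (w : ℂ) : ℝ :=
  let g := firstForm F w
  let h := secondForm F w
  (g Complex.I Complex.I * h 1 1 - 2 * g 1 Complex.I * h 1 Complex.I + g 1 1 * h Complex.I Complex.I) /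
    (2 * (g 1 1 * g Complex.I Complex.I - g 1 Complex.I ^ 2))

/-- The Wirtinger derivative `∂ = (∂ₓ - i ∂_y) / 2`. -/
def dz (g : ℂ → ℂ) (w : ℂ) : ℂ := (fderiv ℝ g w 1 - Complex.I * fderiv ℝ g w Complex.I) / 2

/-- The Wirtinger derivative `∂̄ = (∂ₓ + i ∂_y) / 2`. -/
def dzbar (g : ℂ → ℂ) (w : ℂ) : ℂ := (fderiv ℝ g w 1 + Complex.I * fderiv ℝ g w Complex.I) / 2

/-- The components `Zₖ` of `F⁻¹ ∂F = ∑ Zₖ eₖ`. -/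
def zComp (F : ℂ → Nil) (w : ℂ) (k : Fin 3) : ℂ :=
  ((mcForm F w 1 k : ℂ) - Complex.I * (mcForm F w Complex.I k : ℂ)) / 2

/-- `ψ = (ψ₁, ψ₂)` is a (smooth) generating spinor of the conformal map `F` on the open
set `W`. -/
structure IsGeneratingSpinor (F : ℂ → Nil) (W : Set ℂ) (ψ₁ ψ₂ : ℂ → ℂ) : Prop where
  smooth₁ : ContDiffOn ℝ ∞ ψ₁ W
  smooth₂ : ContDiffOn ℝ ∞ ψ₂ W
  z₁ : ∀ w ∈ W, zComp F w 0 = Complex.I / 2 * (star (ψ₂ w) ^ 2 + ψ₁ w ^ 2)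
  z₂ : ∀ w ∈ W, zComp F w 1 = 1 / 2 * (star (ψ₂ w) ^ 2 - ψ₁ w ^ 2)
  z₃ : ∀ w ∈ W, zComp F w 2 = ψ₁ w * star (ψ₂ w)

/-- `U` and `V` are continuous potentials on `W` of a Dirac operator
`[[0, ∂], [-∂̄, 0]] + [[U, 0], [0, V]]` that annihilates `ψ`. -/
structure IsDiracPotential (W : Set ℂ) (ψ₁ ψ₂ U V : ℂ → ℂ) : Prop where
  continuous_U : ContinuousOn U W
  continuous_V : ContinuousOn V W
  dirac₁ : ∀ w ∈ W, dz ψ₂ w + U w * ψ₁ w = 0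
  dirac₂ : ∀ w ∈ W, -dzbar ψ₁ w + V w * ψ₂ w = 0

section Surface

variable {M : Type*} [TopologicalSpace M] [ChartedSpace ℂ M]

/-- The smooth map `f` from the Riemann surface `M` to Nil is a conformal immersion. -/
structure IsConformalImmersion (f : M → Nil) : Prop where
  smooth_x : ContMDiff 𝓘(ℝ, ℂ) 𝓘(ℝ, ℝ) ∞ fun p => (f p).x
  smooth_y : ContMDiff 𝓘(ℝ, ℂ) 𝓘(ℝ, ℝ) ∞ fun p => (f p).y
  smooth_z : ContMDiff 𝓘(ℝ, ℂ) 𝓘(ℝ, ℝ) ∞ fun p => (f p).z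
  conformal : ∀ φ ∈ IsManifold.maximalAtlas 𝓘(ℂ) ω M, ∀ w ∈ φ.target,
    0 < firstForm (f ∘ φ.symm) w 1 1 ∧
    firstForm (f ∘ φ.symm) w 1 1 = firstForm (f ∘ φ.symm) w Complex.I Complex.I ∧
    firstForm (f ∘ φ.symm) w 1 Complex.I = 0

/-- `c` is the value at `w` of the product `U V` of the potentials of the Dirac operator of a
generating spinor of the surface, in the conformal parameter `φ` near `w`. -/
def IsEnergyCoeff (f : M → Nil) (φ : OpenPartialHomeomorph M ℂ) (w c : ℂ) : Prop :=
  ∃ (W : Set ℂ) (ψ₁ ψ₂ U V : ℂ → ℂ), IsOpen W ∧ w ∈ W ∧ W ⊆ φ.target ∧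
    IsGeneratingSpinor (f ∘ φ.symm) W ψ₁ ψ₂ ∧ IsDiracPotential W ψ₁ ψ₂ U V ∧ c = U w * V w

/-- The coefficient `U V` of the energy form `U V (i/2) dz ∧ dz̄` in the conformal
parameter `φ`. -/
def energyCoeff (f : M → Nil) (φ : OpenPartialHomeomorph M ℂ) (w : ℂ) : ℂ :=
  Classical.epsilon (IsEnergyCoeff f φ w)

/-- The value `(ψ₁, ψ₂)` at `w` of a generating spinor of the surface in the conformal
parameter `φ` near `w`. It is unique up to a common sign of `ψ₁` and `ψ₂`; only the moduli are
used below. -/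
def spinorAt (f : M → Nil) (φ : OpenPartialHomeomorph M ℂ) (w : ℂ) : ℂ × ℂ :=
  Classical.epsilon fun s => ∃ (W : Set ℂ) (ψ₁ ψ₂ : ℂ → ℂ), IsOpen W ∧ w ∈ W ∧ W ⊆ φ.target ∧
    IsGeneratingSpinor (f ∘ φ.symm) W ψ₁ ψ₂ ∧ s = (ψ₁ w, ψ₂ w)

/-- The coefficients `c φ`, one for each holomorphic chart `φ`, define a continuous 2-form
`c φ (i/2) dz ∧ dz̄` on `M`. -/
structure IsContinuousTwoForm (c : OpenPartialHomeomorph M ℂ → ℂ → ℂ) : Prop where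
  continuousOn : ∀ φ ∈ IsManifold.maximalAtlas 𝓘(ℂ) ω M, ContinuousOn (c φ) φ.target
  transform : ∀ φ ∈ IsManifold.maximalAtlas 𝓘(ℂ) ω M,
    ∀ χ ∈ IsManifold.maximalAtlas 𝓘(ℂ) ω M, ∀ p ∈ φ.source ∩ χ.source,
    c φ (φ p) = (‖deriv (χ ∘ φ.symm) (φ p)‖ : ℂ) ^ 2 * c χ (χ p)

variable [CompactSpace M] [T2Space M]

variable (M) in
theorem exists_chartPartition : ∃ ρ : PartitionOfUnity M M Set.univ,
    ρ.IsSubordinate fun p => (chartAt ℂ p).source :=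
  PartitionOfUnity.exists_isSubordinate isClosed_univ _ (fun p => (chartAt ℂ p).open_source)
    fun p _ => Set.mem_iUnion.2 ⟨p, mem_chart_source ℂ p⟩

variable (M) in
/-- A partition of unity subordinate to the charts of `M`. -/
def chartPartition : PartitionOfUnity M M Set.univ := (exists_chartPartition M).choose

/-- The integral over the closed surface `M` of the 2-form with the expression
`c φ (i/2) dz ∧ dz̄ = c φ dx ∧ dy` in the chart `φ`, by a partition of unity; only finitely many
terms of the sum are nonzero. -/
def surfaceIntegral {E : Type*} [NormedAddCommGroup E] [NormedSpace ℝ E]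
    (c : OpenPartialHomeomorph M ℂ → ℂ → E) : E :=
  ∑ᶠ p : M, ∫ w in (chartAt ℂ p).target,
    chartPartition M p ((chartAt ℂ p).symm w) • c (chartAt ℂ p) w

/-- The spinor energy `E(M) = ∫_M U V (i/2) dz ∧ dz̄`. -/
def spinorEnergy (f : M → Nil) : ℂ := surfaceIntegral (energyCoeff f)

end Surface

end

/-!
Locally `Z = f⁻¹∂f` is a null vector, so a generating spinor `ψ` is extracted from it by square
roots. The Maurer–Cartan equations of Nil say that the imaginary parts of `∂̄Z₁` and `∂̄Z₂` vanish
and that the one of `∂̄Z₃` is `Im (Z₁ Z̄₂)`. The first two give `ψ₂∂ψ₂ + ψ₁∂̄ψ₁ = 0`, which makes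
both Dirac equations hold with one common potential `P = U = V`; the third gives
`Im P = (|ψ₂|² - |ψ₁|²) / 4`, and the trace of the second fundamental form gives
`Re P = H (|ψ₁|² + |ψ₂|²) / 2`. By the formula for `Im P` neither component of `ψ` vanishes on an
open set, so by continuity `P` is the only potential.

Hence `Re (UV) = Re P²` is the stated density, whereas `Im (UV) = 2 Re P Im P` is half the real
part of `∂̄Z₃`, where `Z₃ dz` is a global 1-form: it integrates to zero by the Stokes theorem.
-/

noncomputable section

/-! ### Wirtinger derivatives -/

section Wirtinger

variable {g h τ : ℂ → ℂ} {w : ℂ}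

theorem fderiv_apply_eq_dz_add_dzbar (g : ℂ → ℂ) (w v : ℂ) :
    fderiv ℝ g w v = dz g w * v + dzbar g w * star v := by
  have hv : fderiv ℝ g w v = v.re * fderiv ℝ g w 1 + v.im * fderiv ℝ g w Complex.I := by
    have hdecomp : v = v.re • (1 : ℂ) + v.im • Complex.I := by simp
    conv_lhs => rw [hdecomp, map_add, map_smul, map_smul]
    simp only [Complex.real_smul]
  have hstar : star v = v.re - v.im * Complex.I := by apply Complex.ext <;> simp
  rw [hv, hstar, dz, dzbar]
  linear_combination (v.im * fderiv ℝ g w Complex.I) * Complex.I_mul_I +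
    (fderiv ℝ g w 1 - Complex.I * fderiv ℝ g w Complex.I) / 2 * Complex.re_add_im v

theorem dz_congr (hgh : g =ᶠ[nhds w] h) : dz g w = dz h w := by
  simp only [dz, hgh.fderiv_eq]

theorem dzbar_congr (hgh : g =ᶠ[nhds w] h) : dzbar g w = dzbar h w := by
  simp only [dzbar, hgh.fderiv_eq]

theorem dzbar_add (hg : DifferentiableAt ℝ g w) (hh : DifferentiableAt ℝ h w) :
    dzbar (fun u => g u + h u) w = dzbar g w + dzbar h w := by
  simp only [dzbar, fderiv_fun_add hg hh, _root_.add_apply]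
  ring

theorem dzbar_sub (hg : DifferentiableAt ℝ g w) (hh : DifferentiableAt ℝ h w) :
    dzbar (fun u => g u - h u) w = dzbar g w - dzbar h w := by
  simp only [dzbar, fderiv_fun_sub hg hh, _root_.sub_apply]
  ring

theorem dz_mul (hg : DifferentiableAt ℝ g w) (hh : DifferentiableAt ℝ h w) :
    dz (fun u => g u * h u) w = dz g w * h w + g w * dz h w := by
  simp only [dz, fderiv_fun_mul hg hh, _root_.add_apply, _root_.smul_apply, smul_eq_mul]
  ring

theorem dzbar_mul (hg : DifferentiableAt ℝ g w) (hh : DifferentiableAt ℝ h w) :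
    dzbar (fun u => g u * h u) w = dzbar g w * h w + g w * dzbar h w := by
  simp only [dzbar, fderiv_fun_mul hg hh, _root_.add_apply, _root_.smul_apply, smul_eq_mul]
  ring

theorem dzbar_const_mul (c : ℂ) (hg : DifferentiableAt ℝ g w) :
    dzbar (fun u => c * g u) w = c * dzbar g w := by
  simp only [dzbar, fderiv_const_mul hg, _root_.smul_apply, smul_eq_mul]
  ring

theorem dz_star (g : ℂ → ℂ) (w : ℂ) :
    dz (fun u => star (g u)) w = star (dzbar g w) := by
  simp only [dz, dzbar, fderiv_star, ContinuousLinearMap.comp_apply]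
  simp [sub_eq_add_neg]

theorem dzbar_star (g : ℂ → ℂ) (w : ℂ) :
    dzbar (fun u => star (g u)) w = star (dz g w) := by
  simp only [dz, dzbar, fderiv_star, ContinuousLinearMap.comp_apply]
  simp

theorem dz_eq_deriv (hτ : DifferentiableAt ℂ τ w) : dz τ w = deriv τ w := by
  simp only [dz, (hτ.hasFDerivAt.restrictScalars ℝ).fderiv,
    ContinuousLinearMap.coe_restrictScalars', fderiv_eq_smul_deriv, smul_eq_mul]
  linear_combination -deriv τ w / 2 * Complex.I_mul_I

theorem dzbar_eq_zero (hτ : DifferentiableAt ℂ τ w) : dzbar τ w = 0 := by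
  simp only [dzbar, (hτ.hasFDerivAt.restrictScalars ℝ).fderiv,
    ContinuousLinearMap.coe_restrictScalars', fderiv_eq_smul_deriv, smul_eq_mul]
  linear_combination deriv τ w / 2 * Complex.I_mul_I

theorem fderiv_comp_apply_eq_dz_add_dzbar (hg : DifferentiableAt ℝ g (τ w))
    (hτ : DifferentiableAt ℝ τ w) (v : ℂ) :
    fderiv ℝ (fun u => g (τ u)) w v =
      dz g (τ w) * fderiv ℝ τ w v + dzbar g (τ w) * star (fderiv ℝ τ w v) := by
  rw [← fderiv_apply_eq_dz_add_dzbar, ← ContinuousLinearMap.comp_apply]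
  exact congrArg (· v) (fderiv_comp w hg hτ)

theorem dz_comp (hg : DifferentiableAt ℝ g (τ w)) (hτ : DifferentiableAt ℝ τ w) :
    dz (fun u => g (τ u)) w = dz g (τ w) * dz τ w + dzbar g (τ w) * star (dzbar τ w) := by
  rw [dz, fderiv_comp_apply_eq_dz_add_dzbar hg hτ, fderiv_comp_apply_eq_dz_add_dzbar hg hτ]
  simp only [dz, dzbar, star_div₀, star_add, star_mul', Complex.star_def, Complex.conj_I,
    map_ofNat]
  ring

theorem dzbar_comp (hg : DifferentiableAt ℝ g (τ w)) (hτ : DifferentiableAt ℝ τ w) :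
    dzbar (fun u => g (τ u)) w = dz g (τ w) * dzbar τ w + dzbar g (τ w) * star (dz τ w) := by
  rw [dzbar, fderiv_comp_apply_eq_dz_add_dzbar hg hτ, fderiv_comp_apply_eq_dz_add_dzbar hg hτ]
  simp only [dz, dzbar, star_div₀, star_sub, star_mul', Complex.star_def, Complex.conj_I,
    map_ofNat]
  ring

theorem dz_comp_holomorphic (hg : DifferentiableAt ℝ g (τ w)) (hτ : DifferentiableAt ℂ τ w) :
    dz (fun u => g (τ u)) w = dz g (τ w) * deriv τ w := by
  rw [dz_comp hg (hτ.restrictScalars ℝ), dz_eq_deriv hτ, dzbar_eq_zero hτ, star_zero, mul_zero,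
    add_zero]

theorem dzbar_comp_holomorphic (hg : DifferentiableAt ℝ g (τ w)) (hτ : DifferentiableAt ℂ τ w) :
    dzbar (fun u => g (τ u)) w = dzbar g (τ w) * star (deriv τ w) := by
  rw [dzbar_comp hg (hτ.restrictScalars ℝ), dz_eq_deriv hτ, dzbar_eq_zero hτ, mul_zero, zero_add]

theorem contDiffAt_dz {m n : WithTop ℕ∞} (hg : ContDiffAt ℝ n g w) (hmn : m + 1 ≤ n) :
    ContDiffAt ℝ m (dz g) w :=
  have hfderiv (v : ℂ) : ContDiffAt ℝ m (fun u => fderiv ℝ g u v) w :=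
    (hg.fderiv_right hmn).clm_apply contDiffAt_const
  ((hfderiv 1).sub (contDiffAt_const.mul (hfderiv Complex.I))).div_const 2

theorem contDiffAt_dzbar {m n : WithTop ℕ∞} (hg : ContDiffAt ℝ n g w) (hmn : m + 1 ≤ n) :
    ContDiffAt ℝ m (dzbar g) w :=
  have hfderiv (v : ℂ) : ContDiffAt ℝ m (fun u => fderiv ℝ g u v) w :=
    (hg.fderiv_right hmn).clm_apply contDiffAt_const
  ((hfderiv 1).add (contDiffAt_const.mul (hfderiv Complex.I))).div_const 2

theorem fderiv_ofReal_apply (u : ℂ → ℝ) (w v : ℂ) :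
    fderiv ℝ (fun t => (u t : ℂ)) w v = (fderiv ℝ u w v : ℂ) := by
  by_cases hu : DifferentiableAt ℝ u w
  · exact congrArg (· v) (Complex.ofRealCLM.hasFDerivAt.comp w hu.hasFDerivAt).fderiv
  · have hu' : ¬DifferentiableAt ℝ (fun t => (u t : ℂ)) w := fun h =>
      hu (Complex.reCLM.differentiableAt.comp w h)
    simp [fderiv_zero_of_not_differentiableAt hu, fderiv_zero_of_not_differentiableAt hu']

theorem dz_ofReal (u : ℂ → ℝ) (w : ℂ) :
    dz (fun t => (u t : ℂ)) w = (fderiv ℝ u w 1 - Complex.I * fderiv ℝ u w Complex.I) / 2 := by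
  rw [dz, fderiv_ofReal_apply, fderiv_ofReal_apply]

theorem dzbar_ofReal (u : ℂ → ℝ) (w : ℂ) :
    dzbar (fun t => (u t : ℂ)) w = (fderiv ℝ u w 1 + Complex.I * fderiv ℝ u w Complex.I) / 2 := by
  rw [dzbar, fderiv_ofReal_apply, fderiv_ofReal_apply]

theorem dzbar_ofReal_eq_star_dz (u : ℂ → ℝ) (w : ℂ) :
    dzbar (fun t => (u t : ℂ)) w = star (dz (fun t => (u t : ℂ)) w) := by
  simp [dz_ofReal, dzbar_ofReal]

theorem dzbar_ofReal_sub_I_mul {a b : ℂ → ℝ} (ha : DifferentiableAt ℝ a w)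
    (hb : DifferentiableAt ℝ b w) :
    dzbar (fun t => ((a t : ℂ) - Complex.I * b t) / 2) w =
      ⟨(fderiv ℝ a w 1 + fderiv ℝ b w Complex.I) / 4,
        (fderiv ℝ a w Complex.I - fderiv ℝ b w 1) / 4⟩ := by
  have ha' : DifferentiableAt ℝ (fun t => (a t : ℂ)) w :=
    Complex.ofRealCLM.differentiableAt.comp w ha
  have hb' : DifferentiableAt ℝ (fun t => (b t : ℂ)) w :=
    Complex.ofRealCLM.differentiableAt.comp w hb
  simp only [div_eq_inv_mul _ (2 : ℂ)]
  rw [dzbar_const_mul _ (ha'.fun_sub (hb'.const_mul _)), dzbar_sub ha' (hb'.const_mul _),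
    dzbar_const_mul _ hb', dzbar_ofReal, dzbar_ofReal]
  have hfour (p q r s : ℝ) : (2 : ℂ)⁻¹ * ((p + Complex.I * q) / 2 - Complex.I *
      ((r + Complex.I * s) / 2)) = ((p + s) / 4 : ℝ) + ((q - r) / 4 : ℝ) * Complex.I := by
    push_cast
    linear_combination -(s / 4 : ℂ) * Complex.I_sq
  rw [hfour, Complex.mk_eq_add_mul_I]

theorem fderiv_fderiv_apply_comm {E G : Type*} [NormedAddCommGroup E] [NormedSpace ℝ E]
    [NormedAddCommGroup G] [NormedSpace ℝ G] {u : E → G} {p : E} (hu : ContDiffAt ℝ 2 u p)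
    (a b : E) :
    fderiv ℝ (fun t => fderiv ℝ u t a) p b = fderiv ℝ (fun t => fderiv ℝ u t b) p a := by
  have hdiff : DifferentiableAt ℝ (fderiv ℝ u) p :=
    (hu.fderiv_right (m := 1) (by norm_num)).differentiableAt one_ne_zero
  have hsnd (c d : E) : fderiv ℝ (fun t => fderiv ℝ u t c) p d = fderiv ℝ (fderiv ℝ u) p d c := by
    simp [fderiv_clm_apply hdiff (differentiableAt_const c)]
  rw [hsnd, hsnd]
  exact hu.isSymmSndFDerivAt (by simp) b a

/-- `∂̄∂` is a quarter of the Laplacian, a real operator. -/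
theorem im_dzbar_dz_ofReal {u : ℂ → ℝ} (hu : ContDiffAt ℝ 2 u w) :
    (dzbar (dz fun t => (u t : ℂ)) w).im = 0 := by
  have hpartial (v : ℂ) : DifferentiableAt ℝ (fun t => fderiv ℝ u t v) w :=
    ((hu.fderiv_right (m := 1) (by norm_num)).clm_apply contDiffAt_const).differentiableAt
      one_ne_zero
  rw [funext (dz_ofReal u), dzbar_ofReal_sub_I_mul (hpartial 1) (hpartial Complex.I)]
  simp only [fderiv_fderiv_apply_comm hu 1 Complex.I, sub_self, zero_div]

end Wirtinger

/-! ### The Maurer–Cartan form and conformal immersions -/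

/-- The coordinates of the map `F` to Nil are `n` times continuously differentiable at `w`. -/
structure NilContDiffAt (n : WithTop ℕ∞) (F : ℂ → Nil) (w : ℂ) : Prop where
  x : ContDiffAt ℝ n (fun u => (F u).x) w
  y : ContDiffAt ℝ n (fun u => (F u).y) w
  z : ContDiffAt ℝ n (fun u => (F u).z) w

section MaurerCartan

variable {F G : ℂ → Nil} {τ : ℂ → ℂ} {m n : WithTop ℕ∞} {w : ℂ}

theorem mcForm_eq (F : ℂ → Nil) (w v : ℂ) :
    mcForm F w v = ![fderiv ℝ (fun u => (F u).x) w v, fderiv ℝ (fun u => (F u).y) w v,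
      fderiv ℝ (fun u => (F u).z) w v - (F w).x * fderiv ℝ (fun u => (F u).y) w v] := by
  rw [mcForm, ← Nil.leftCoord_eq]
  congr 1
  ext i j
  fin_cases i <;> fin_cases j <;> simp [Nil.toMatrix]

theorem mcForm_congr (hFG : F =ᶠ[nhds w] G) (v : ℂ) : mcForm F w v = mcForm G w v := by
  have hcoord (c : Nil → ℝ) : fderiv ℝ (fun u => c (F u)) w = fderiv ℝ (fun u => c (G u)) w :=
    (hFG.fun_comp c).fderiv_eq
  rw [mcForm_eq, mcForm_eq, hcoord Nil.x, hcoord Nil.y, hcoord Nil.z, hFG.eq_of_nhds]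

theorem zComp_congr (hFG : F =ᶠ[nhds w] G) (k : Fin 3) : zComp F w k = zComp G w k := by
  rw [zComp, zComp, mcForm_congr hFG, mcForm_congr hFG]

theorem mcForm_one (F : ℂ → Nil) (w : ℂ) (k : Fin 3) : mcForm F w 1 k = 2 * (zComp F w k).re := by
  simp [zComp, mul_div_cancel₀]

theorem mcForm_I (F : ℂ → Nil) (w : ℂ) (k : Fin 3) :
    mcForm F w Complex.I k = -2 * (zComp F w k).im := by
  simp [zComp, mul_div_cancel₀]

theorem zComp_eq (F : ℂ → Nil) (w : ℂ) :
    zComp F w = ![dz (fun u => ((F u).x : ℂ)) w, dz (fun u => ((F u).y : ℂ)) w,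
      dz (fun u => ((F u).z : ℂ)) w - (F w).x * dz (fun u => ((F u).y : ℂ)) w] := by
  simp only [dz_ofReal]
  ext k
  fin_cases k
  · simp [zComp, mcForm_eq]
  · simp [zComp, mcForm_eq]
  · simp only [zComp, Fin.reduceFinMk, mcForm_eq, Matrix.cons_val, Complex.ofReal_sub,
      Complex.ofReal_mul]
    ring

namespace NilContDiffAt

theorem of_le (hF : NilContDiffAt n F w) (hmn : m ≤ n) : NilContDiffAt m F w :=
  ⟨hF.x.of_le hmn, hF.y.of_le hmn, hF.z.of_le hmn⟩

theorem contDiffAt_mcForm (hF : NilContDiffAt n F w) (hmn : m + 1 ≤ n) (v : ℂ) (k : Fin 3) :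
    ContDiffAt ℝ m (fun u => mcForm F u v k) w := by
  have hpartial {c : ℂ → ℝ} (hc : ContDiffAt ℝ n c w) :
      ContDiffAt ℝ m (fun u => fderiv ℝ c u v) w :=
    (hc.fderiv_right hmn).clm_apply contDiffAt_const
  simp only [mcForm_eq]
  fin_cases k
  · exact hpartial hF.x
  · exact hpartial hF.y
  · exact (hpartial hF.z).sub ((hF.x.of_le (le_self_add.trans hmn)).mul (hpartial hF.y))

theorem contDiffAt_zComp (hF : NilContDiffAt n F w) (hmn : m + 1 ≤ n) (k : Fin 3) :
    ContDiffAt ℝ m (fun u => zComp F u k) w := by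
  have hcast (v : ℂ) : ContDiffAt ℝ m (fun u => (mcForm F u v k : ℂ)) w :=
    Complex.ofRealCLM.contDiff.contDiffAt.comp w (hF.contDiffAt_mcForm hmn v k)
  exact ((hcast 1).sub (contDiffAt_const.mul (hcast Complex.I))).div_const 2

theorem ofReal_x (hF : NilContDiffAt n F w) : ContDiffAt ℝ n (fun u => ((F u).x : ℂ)) w :=
  Complex.ofRealCLM.contDiff.contDiffAt.comp w hF.x

theorem ofReal_y (hF : NilContDiffAt n F w) : ContDiffAt ℝ n (fun u => ((F u).y : ℂ)) w :=
  Complex.ofRealCLM.contDiff.contDiffAt.comp w hF.y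

theorem ofReal_z (hF : NilContDiffAt n F w) : ContDiffAt ℝ n (fun u => ((F u).z : ℂ)) w :=
  Complex.ofRealCLM.contDiff.contDiffAt.comp w hF.z

theorem zComp_comp (hF : NilContDiffAt 1 F (τ w)) (hτ : DifferentiableAt ℂ τ w) (k : Fin 3) :
    zComp (F ∘ τ) w k = zComp F (τ w) k * deriv τ w := by
  have hdz {c : ℂ → ℂ} (hc : ContDiffAt ℝ 1 c (τ w)) :
      dz (fun u => c (τ u)) w = dz c (τ w) * deriv τ w :=
    dz_comp_holomorphic (hc.differentiableAt one_ne_zero) hτ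
  rw [zComp_eq, zComp_eq]
  fin_cases k
  · exact hdz hF.ofReal_x
  · exact hdz hF.ofReal_y
  · simp only [Fin.reduceFinMk, Matrix.cons_val, Function.comp_apply, hdz hF.ofReal_y,
      hdz hF.ofReal_z]
    ring

theorem im_dzbar_zComp_zero (hF : NilContDiffAt 2 F w) :
    (dzbar (fun u => zComp F u 0) w).im = 0 := by
  simp only [zComp_eq]
  exact im_dzbar_dz_ofReal hF.x

theorem im_dzbar_zComp_one (hF : NilContDiffAt 2 F w) :
    (dzbar (fun u => zComp F u 1) w).im = 0 := by
  simp only [zComp_eq]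
  exact im_dzbar_dz_ofReal hF.y

/-- The only nontrivial Maurer–Cartan equation of Nil, `d(dz - x dy) = -dx ∧ dy`. -/
theorem im_dzbar_zComp_two (hF : NilContDiffAt 2 F w) :
    (dzbar (fun u => zComp F u 2) w).im = (zComp F w 0 * star (zComp F w 1)).im := by
  have hx := hF.ofReal_x.differentiableAt two_ne_zero
  have hdy := (contDiffAt_dz (m := 1) hF.ofReal_y (by norm_num)).differentiableAt one_ne_zero
  have hdz := (contDiffAt_dz (m := 1) hF.ofReal_z (by norm_num)).differentiableAt one_ne_zero
  have hZ : dzbar (fun u => zComp F u 2) w =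
      dzbar (dz fun u => ((F u).z : ℂ)) w -
        (star (dz (fun u => ((F u).x : ℂ)) w) * dz (fun u => ((F u).y : ℂ)) w +
          (F w).x * dzbar (dz fun u => ((F u).y : ℂ)) w) := by
    rw [← dzbar_ofReal_eq_star_dz, ← dzbar_mul hx hdy,
      ← dzbar_sub hdz (hx.fun_mul hdy)]
    simp only [zComp_eq]
    rfl
  rw [hZ, zComp_eq]
  simp only [Matrix.cons_val, Complex.star_def, Complex.sub_im, Complex.add_im, Complex.mul_im,
    Complex.conj_re, Complex.conj_im, Complex.ofReal_re, Complex.ofReal_im,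
    im_dzbar_dz_ofReal hF.y, im_dzbar_dz_ofReal hF.z]
  ring

theorem re_dzbar_zComp (hF : NilContDiffAt 2 F w) (k : Fin 3) :
    4 * (dzbar (fun u => zComp F u k) w).re =
      fderiv ℝ (fun u => mcForm F u 1 k) w 1 +
        fderiv ℝ (fun u => mcForm F u Complex.I k) w Complex.I := by
  have hmc (v : ℂ) : DifferentiableAt ℝ (fun u => mcForm F u v k) w :=
    (hF.contDiffAt_mcForm (m := 1) (by norm_num) v k).differentiableAt one_ne_zero
  simp only [zComp, dzbar_ofReal_sub_I_mul (hmc 1) (hmc Complex.I)]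
  ring

end NilContDiffAt

end MaurerCartan

section ConformalGeometry

variable {F : ℂ → Nil} {w : ℂ}

theorem crossProduct_mcForm (F : ℂ → Nil) (w : ℂ) :
    crossProduct (mcForm F w 1) (mcForm F w Complex.I) =
      ![4 * (zComp F w 1 * star (zComp F w 2)).im, 4 * (zComp F w 2 * star (zComp F w 0)).im,
        4 * (zComp F w 0 * star (zComp F w 1)).im] := by
  ext k
  fin_cases k <;>
  · simp only [Fin.zero_eta, Fin.mk_one, Fin.reduceFinMk, cross_apply, mcForm_one, mcForm_I,
      Matrix.cons_val, Complex.star_def, Complex.mul_im, Complex.conj_re, Complex.conj_im]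
    ring

theorem firstForm_one_one_add_I_I (F : ℂ → Nil) (w : ℂ) :
    firstForm F w 1 1 + firstForm F w Complex.I Complex.I = 4 * ∑ k, ‖zComp F w k‖ ^ 2 := by
  simp only [firstForm, dotProduct, mcForm_one, mcForm_I, ← Complex.normSq_eq_norm_sq,
    Complex.normSq_apply, ← Finset.sum_add_distrib, Finset.mul_sum]
  exact Finset.sum_congr rfl fun k _ => by ring

theorem four_mul_sum_zComp_sq (F : ℂ → Nil) (w : ℂ) :
    4 * ∑ k, zComp F w k ^ 2 =
      ⟨firstForm F w 1 1 - firstForm F w Complex.I Complex.I, -2 * firstForm F w 1 Complex.I⟩ := by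
  simp only [firstForm, dotProduct, mcForm_one, mcForm_I, Fin.sum_univ_three]
  apply Complex.ext <;>
  · simp only [pow_two, Complex.add_re, Complex.add_im, Complex.mul_re, Complex.mul_im,
      Complex.re_ofNat, Complex.im_ofNat]
    ring

theorem structureConst_eq :
    Nil.structureConst = ![![0, ![0, 0, 1], 0], ![![0, 0, -1], 0, 0], 0] := by
  ext i j k
  fin_cases i <;> fin_cases j <;> fin_cases k <;>
    simp [Nil.structureConst, Nil.coord, Nil.basis]

theorem covDeriv_eq (F : ℂ → Nil) (w u v : ℂ) : covDeriv F w u v =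
    ![fderiv ℝ (fun t => mcForm F t v 0) w u +
        (mcForm F w u 1 * mcForm F w v 2 + mcForm F w u 2 * mcForm F w v 1) / 2,
      fderiv ℝ (fun t => mcForm F t v 1) w u -
        (mcForm F w u 0 * mcForm F w v 2 + mcForm F w u 2 * mcForm F w v 0) / 2,
      fderiv ℝ (fun t => mcForm F t v 2) w u +
        (mcForm F w u 0 * mcForm F w v 1 - mcForm F w u 1 * mcForm F w v 0) / 2] := by
  ext i
  fin_cases i <;>
  · simp only [Fin.zero_eta, Fin.mk_one, Fin.reduceFinMk, covDeriv, Nil.connection,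
      structureConst_eq, Fin.sum_univ_three, Matrix.cons_val, Pi.zero_apply]
    ring

theorem trace_covDeriv (hF : NilContDiffAt 2 F w) :
    covDeriv F w 1 1 + covDeriv F w Complex.I Complex.I =
      ![4 * (dzbar (fun u => zComp F u 0) w + zComp F w 1 * star (zComp F w 2)).re,
        4 * (dzbar (fun u => zComp F u 1) w - zComp F w 0 * star (zComp F w 2)).re,
        4 * (dzbar (fun u => zComp F u 2) w).re] := by
  simp only [Complex.add_re, Complex.sub_re, mul_add, mul_sub, hF.re_dzbar_zComp, covDeriv_eq,
    mcForm_one, mcForm_I, Complex.star_def, Complex.mul_re, Complex.conj_re, Complex.conj_im]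
  ext k
  fin_cases k <;>
  · simp only [Fin.zero_eta, Fin.mk_one, Fin.reduceFinMk, Pi.add_apply, Matrix.cons_val]
    ring

/-- The smooth map `F` is an immersion at `w` for which the parameter is conformal. -/
structure IsConformalAt (F : ℂ → Nil) (w : ℂ) : Prop where
  smooth : NilContDiffAt ∞ F w
  pos : 0 < firstForm F w 1 1
  eq : firstForm F w 1 1 = firstForm F w Complex.I Complex.I
  orth : firstForm F w 1 Complex.I = 0

namespace IsConformalAt

theorem contDiffAt_two (hF : IsConformalAt F w) : NilContDiffAt 2 F w :=
  hF.smooth.of_le ENat.LEInfty.out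

theorem sum_zComp_sq (hF : IsConformalAt F w) : ∑ k, zComp F w k ^ 2 = 0 := by
  have hsum : 4 * ∑ k, zComp F w k ^ 2 = 0 := by
    rw [four_mul_sum_zComp_sq, hF.eq, hF.orth, sub_self, mul_zero]
    rfl
  simpa only [mul_eq_zero, OfNat.ofNat_ne_zero, false_or] using hsum

theorem firstForm_one_one (hF : IsConformalAt F w) :
    firstForm F w 1 1 = 2 * ∑ k, ‖zComp F w k‖ ^ 2 := by
  have hsum := firstForm_one_one_add_I_I F w
  rw [← hF.eq] at hsum
  linarith

theorem two_mul_meanCurvature_mul (hF : IsConformalAt F w) :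
    2 * meanCurvature F w * firstForm F w 1 1 =
      (covDeriv F w 1 1 + covDeriv F w Complex.I Complex.I) ⬝ᵥ unitNormal F w := by
  have hpos := hF.pos
  simp only [meanCurvature, secondForm, hF.orth, ← hF.eq, add_dotProduct]
  field_simp
  ring

end IsConformalAt

end ConformalGeometry

/-! ### Existence of generating spinors -/

section Existence

theorem exists_contDiffOn_sq_eq {𝕜 E : Type*} [NontriviallyNormedField 𝕜] [NormedAlgebra 𝕜 ℂ]
    [NormedAddCommGroup E] [NormedSpace 𝕜 E] {n : WithTop ℕ∞} {g : E → ℂ} {W : Set E} {w : E}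
    (hg : ContDiffOn 𝕜 n g W) (hW : IsOpen W) (hw : w ∈ W) (hgw : g w ≠ 0) :
    ∃ W' ⊆ W, IsOpen W' ∧ w ∈ W' ∧ ∃ s : E → ℂ, ContDiffOn 𝕜 n s W' ∧
      ∀ u ∈ W', s u ≠ 0 ∧ s u ^ 2 = g u := by
  have hdiv : ContDiffOn 𝕜 n (fun u => g u / g w) W := hg.div_const _
  refine ⟨W ∩ (fun u => g u / g w) ⁻¹' Complex.slitPlane, Set.inter_subset_left,
    hdiv.continuousOn.isOpen_inter_preimage hW Complex.isOpen_slitPlane, ⟨hw, by simp [hgw]⟩,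
    fun u => Complex.exp (Complex.log (g w) / 2) * Complex.exp (Complex.log (g u / g w) / 2),
    ?_, fun u hu => ⟨mul_ne_zero (Complex.exp_ne_zero _) (Complex.exp_ne_zero _), ?_⟩⟩
  · have hlog : ContDiffOn 𝕜 n (fun u => Complex.log (g u / g w))
        (W ∩ (fun u => g u / g w) ⁻¹' Complex.slitPlane) := fun u hu =>
      have hlogAt : ContDiffAt 𝕜 n Complex.log (g u / g w) :=
        (Complex.contDiffAt_log hu.2).restrict_scalars 𝕜
      hlogAt.comp_contDiffWithinAt (f := fun u => g u / g w) u
        (hdiv.mono Set.inter_subset_left u hu)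
    exact contDiffOn_const.mul (Complex.contDiff_exp.comp_contDiffOn (hlog.div_const 2))
  · beta_reduce
    rw [← Complex.exp_add, ← add_div, ← Complex.exp_nat_mul, Nat.cast_ofNat,
      mul_div_cancel₀ _ two_ne_zero, Complex.exp_add, Complex.exp_log hgw,
      Complex.exp_log (Complex.slitPlane_ne_zero hu.2), mul_div_cancel₀ _ hgw]

theorem exists_contDiffOn_sq_eq_sq_eq_mul_eq {𝕜 E : Type*} [NontriviallyNormedField 𝕜]
    [NormedAlgebra 𝕜 ℂ] [NormedAddCommGroup E] [NormedSpace 𝕜 E] {n : WithTop ℕ∞}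
    {A B C : E → ℂ} {W : Set E} {w : E} (hA : ContDiffOn 𝕜 n A W) (hC : ContDiffOn 𝕜 n C W)
    (hW : IsOpen W) (hw : w ∈ W) (hABC : ∀ u ∈ W, A u * B u = C u ^ 2) (hAw : A w ≠ 0) :
    ∃ W' ⊆ W, IsOpen W' ∧ w ∈ W' ∧ ∃ a b : E → ℂ, ContDiffOn 𝕜 n a W' ∧ ContDiffOn 𝕜 n b W' ∧
      ∀ u ∈ W', a u ^ 2 = A u ∧ b u ^ 2 = B u ∧ a u * b u = C u := by
  obtain ⟨W', hW'W, hW', hw', a, ha, hsq⟩ := exists_contDiffOn_sq_eq hA hW hw hAw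
  refine ⟨W', hW'W, hW', hw', a, fun u => C u / a u, ha,
    (hC.mono hW'W).mul (ha.inv fun u hu => (hsq u hu).1), fun u hu => ?_⟩
  obtain ⟨hau, hasq⟩ := hsq u hu
  refine ⟨hasq, ?_, mul_div_cancel₀ _ hau⟩
  rw [div_pow, ← hABC u (hW'W hu), ← hasq, mul_div_cancel_left₀ _ (pow_ne_zero 2 hau)]

/-- The value that the defining relations of a generating spinor prescribe for `ψ₁²`. -/
def spinorSq₁ (F : ℂ → Nil) (w : ℂ) : ℂ := -Complex.I * zComp F w 0 - zComp F w 1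

/-- The value that the defining relations of a generating spinor prescribe for the square of
the conjugate of `ψ₂`. -/
def spinorSq₂ (F : ℂ → Nil) (w : ℂ) : ℂ := -Complex.I * zComp F w 0 + zComp F w 1

variable {F : ℂ → Nil} {W : Set ℂ} {ψ₁ ψ₂ : ℂ → ℂ} {w : ℂ}

theorem isGeneratingSpinor_iff : IsGeneratingSpinor F W ψ₁ ψ₂ ↔
    ContDiffOn ℝ ∞ ψ₁ W ∧ ContDiffOn ℝ ∞ ψ₂ W ∧ ∀ u ∈ W, ψ₁ u ^ 2 = spinorSq₁ F u ∧
      star (ψ₂ u) ^ 2 = spinorSq₂ F u ∧ ψ₁ u * star (ψ₂ u) = zComp F u 2 := by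
  simp only [spinorSq₁, spinorSq₂]
  constructor
  · intro hψ
    refine ⟨hψ.smooth₁, hψ.smooth₂, fun u hu => ⟨?_, ?_, (hψ.z₃ u hu).symm⟩⟩ <;>
    · rw [hψ.z₁ u hu, hψ.z₂ u hu]
      linear_combination (star (ψ₂ u) ^ 2 + ψ₁ u ^ 2) / 2 * Complex.I_sq
  · rintro ⟨hψ₁, hψ₂, hψ⟩
    refine ⟨hψ₁, hψ₂, fun u hu => ?_, fun u hu => ?_, fun u hu => (hψ u hu).2.2.symm⟩ <;>
      obtain ⟨hsq₁, hsq₂, -⟩ := hψ u hu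
    · linear_combination zComp F u 0 * Complex.I_sq - Complex.I / 2 * (hsq₁ + hsq₂)
    · linear_combination (hsq₁ - hsq₂) / 2

theorem contDiffAt_spinorSq₁ (hF : NilContDiffAt ∞ F w) : ContDiffAt ℝ ∞ (spinorSq₁ F) w :=
  (contDiffAt_const.mul (hF.contDiffAt_zComp (by simp) 0)).sub (hF.contDiffAt_zComp (by simp) 1)

theorem contDiffAt_spinorSq₂ (hF : NilContDiffAt ∞ F w) : ContDiffAt ℝ ∞ (spinorSq₂ F) w :=
  (contDiffAt_const.mul (hF.contDiffAt_zComp (by simp) 0)).add (hF.contDiffAt_zComp (by simp) 1)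

namespace IsConformalAt

theorem spinorSq₁_mul_spinorSq₂ (hF : IsConformalAt F w) :
    spinorSq₁ F w * spinorSq₂ F w = zComp F w 2 ^ 2 := by
  have hsum := hF.sum_zComp_sq
  rw [Fin.sum_univ_three] at hsum
  simp only [spinorSq₁, spinorSq₂]
  linear_combination zComp F w 0 ^ 2 * Complex.I_sq - hsum

theorem spinorSq_ne_zero (hF : IsConformalAt F w) : spinorSq₁ F w ≠ 0 ∨ spinorSq₂ F w ≠ 0 := by
  by_contra! hzero
  obtain ⟨h₁, h₂⟩ := hzero
  have hZ₂ : zComp F w 2 = 0 := by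
    simpa [h₁] using hF.spinorSq₁_mul_spinorSq₂.symm
  simp only [spinorSq₁, spinorSq₂] at h₁ h₂
  have hZ₁ : zComp F w 1 = 0 := by linear_combination (h₂ - h₁) / 2
  have hZ₀ : zComp F w 0 = 0 := by
    linear_combination Complex.I / 2 * (h₁ + h₂) + zComp F w 0 * Complex.I_sq
  exact hF.pos.ne' (by simp [hF.firstForm_one_one, Fin.sum_univ_three, hZ₀, hZ₁, hZ₂])

end IsConformalAt

theorem exists_isGeneratingSpinor (hF : ∀ u ∈ W, IsConformalAt F u) (hW : IsOpen W)
    (hw : w ∈ W) : ∃ W' ⊆ W, IsOpen W' ∧ w ∈ W' ∧ ∃ ψ₁ ψ₂, IsGeneratingSpinor F W' ψ₁ ψ₂ := by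
  have hsq₁ : ContDiffOn ℝ ∞ (spinorSq₁ F) W := fun u hu =>
    (contDiffAt_spinorSq₁ (hF u hu).smooth).contDiffWithinAt
  have hsq₂ : ContDiffOn ℝ ∞ (spinorSq₂ F) W := fun u hu =>
    (contDiffAt_spinorSq₂ (hF u hu).smooth).contDiffWithinAt
  have hZ₂ : ContDiffOn ℝ ∞ (fun u => zComp F u 2) W := fun u hu =>
    ((hF u hu).smooth.contDiffAt_zComp (by simp) 2).contDiffWithinAt
  have hmul : ∀ u ∈ W, spinorSq₁ F u * spinorSq₂ F u = zComp F u 2 ^ 2 := fun u hu =>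
    (hF u hu).spinorSq₁_mul_spinorSq₂
  obtain ⟨W', hW'W, hW', hw', a, b, ha, hb, hab⟩ : ∃ W' ⊆ W, IsOpen W' ∧ w ∈ W' ∧
      ∃ a b : ℂ → ℂ, ContDiffOn ℝ ∞ a W' ∧ ContDiffOn ℝ ∞ b W' ∧
        ∀ u ∈ W', a u ^ 2 = spinorSq₁ F u ∧ b u ^ 2 = spinorSq₂ F u ∧ a u * b u = zComp F u 2 := by
    rcases (hF w hw).spinorSq_ne_zero with hne | hne
    · exact exists_contDiffOn_sq_eq_sq_eq_mul_eq hsq₁ hZ₂ hW hw hmul hne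
    · obtain ⟨W', hW'W, hW', hw', b, a, hb, ha, hba⟩ :=
        exists_contDiffOn_sq_eq_sq_eq_mul_eq hsq₂ hZ₂ hW hw
          (fun u hu => (mul_comm _ _).trans (hmul u hu)) hne
      exact ⟨W', hW'W, hW', hw', a, b, ha, hb, fun u hu =>
        ⟨(hba u hu).2.1, (hba u hu).1, (mul_comm _ _).trans (hba u hu).2.2⟩⟩
  have hstar : ContDiffOn ℝ ∞ (fun u => star (b u)) W' :=
    Complex.conjCLE.toContinuousLinearMap.contDiff.comp_contDiffOn hb
  exact ⟨W', hW'W, hW', hw', a, fun u => star (b u), isGeneratingSpinor_iff.2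
    ⟨ha, hstar, by simpa only [star_star] using hab⟩⟩

end Existence

/-! ### The Dirac equation of a generating spinor -/

/-- The density `|ψ₁|² + |ψ₂|²` of a spinor with the components `a` and `b`; its square is the
conformal factor of the surface. -/
def spinorDensity (a b : ℂ) : ℝ := ‖a‖ ^ 2 + ‖b‖ ^ 2

/-- The Gauss map of the surface, up to the positive factor `spinorDensity a b`, in terms of the
components of a generating spinor. -/
def spinorNormal (a b : ℂ) : Fin 3 → ℝ :=
  ![-2 * (a * b).im, -2 * (a * b).re, ‖b‖ ^ 2 - ‖a‖ ^ 2]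

/-- The common potential `U = V` of the Dirac operator that annihilates a generating spinor:
the solution of both equations `∂ψ₂ = -Pψ₁` and `∂̄ψ₁ = Pψ₂`, which are compatible by
`IsGeneratingSpinor.dz_mul_add_dzbar_mul`. -/
def diracPotential (ψ₁ ψ₂ : ℂ → ℂ) (w : ℂ) : ℂ :=
  (dzbar ψ₁ w * star (ψ₂ w) - dz ψ₂ w * star (ψ₁ w)) / spinorDensity (ψ₁ w) (ψ₂ w)

section SpinorAlgebra

variable (a b : ℂ)

theorem spinorDensity_nonneg : 0 ≤ spinorDensity a b := by
  rw [spinorDensity]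
  positivity

theorem ofReal_spinorDensity : (spinorDensity a b : ℂ) = a * star a + b * star b := by
  simp [spinorDensity, Complex.mul_conj']

theorem spinorNormal_dotProduct_self :
    spinorNormal a b ⬝ᵥ spinorNormal a b = spinorDensity a b ^ 2 := by
  have hnorm : (a * b).re ^ 2 + (a * b).im ^ 2 = ‖a‖ ^ 2 * ‖b‖ ^ 2 := by
    rw [← mul_pow, ← norm_mul, ← Complex.normSq_eq_norm_sq, Complex.normSq_apply]
    ring
  simp only [spinorNormal, spinorDensity, Matrix.vec3_dotProduct, Matrix.cons_val]
  linear_combination 4 * hnorm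

end SpinorAlgebra

namespace IsGeneratingSpinor

variable {F : ℂ → Nil} {W : Set ℂ} {ψ₁ ψ₂ : ℂ → ℂ} {w : ℂ}

section Frame

variable (hψ : IsGeneratingSpinor F W ψ₁ ψ₂) (hw : w ∈ W)
include hψ hw

theorem norm_sq_fst : ‖ψ₁ w‖ ^ 2 = ‖spinorSq₁ F w‖ := by
  rw [← norm_pow, ((isGeneratingSpinor_iff.1 hψ).2.2 w hw).1]

theorem norm_sq_snd : ‖ψ₂ w‖ ^ 2 = ‖spinorSq₂ F w‖ := by
  rw [← norm_star, ← norm_pow, ((isGeneratingSpinor_iff.1 hψ).2.2 w hw).2.1]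

theorem zComp_one_mul_star_zComp_two : zComp F w 1 * star (zComp F w 2) =
    (‖ψ₂ w‖ ^ 2 * star (ψ₁ w * ψ₂ w) - ‖ψ₁ w‖ ^ 2 * (ψ₁ w * ψ₂ w)) / 2 := by
  simp only [hψ.z₂ w hw, hψ.z₃ w hw, ← Complex.mul_conj', Complex.star_def, map_mul,
    Complex.conj_conj]
  ring

theorem zComp_zero_mul_star_zComp_two : zComp F w 0 * star (zComp F w 2) =
    Complex.I / 2 * (‖ψ₂ w‖ ^ 2 * star (ψ₁ w * ψ₂ w) + ‖ψ₁ w‖ ^ 2 * (ψ₁ w * ψ₂ w)) := by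
  simp only [hψ.z₁ w hw, hψ.z₃ w hw, ← Complex.mul_conj', Complex.star_def, map_mul,
    Complex.conj_conj]
  ring

theorem im_zComp_zero_mul_star_zComp_one : (zComp F w 0 * star (zComp F w 1)).im =
    spinorDensity (ψ₁ w) (ψ₂ w) * (‖ψ₂ w‖ ^ 2 - ‖ψ₁ w‖ ^ 2) / 4 := by
  have hmul : zComp F w 0 * star (zComp F w 1) = Complex.I / 4 *
      (((spinorDensity (ψ₁ w) (ψ₂ w) * (‖ψ₂ w‖ ^ 2 - ‖ψ₁ w‖ ^ 2) : ℝ) : ℂ) +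
        ((ψ₁ w * ψ₂ w) ^ 2 - star ((ψ₁ w * ψ₂ w) ^ 2))) := by
    simp only [hψ.z₁ w hw, hψ.z₂ w hw, spinorDensity, Complex.ofReal_mul, Complex.ofReal_add,
      Complex.ofReal_sub, Complex.ofReal_pow, ← Complex.mul_conj', Complex.star_def, map_mul,
      map_sub, map_pow, map_div₀, map_one, map_ofNat, Complex.conj_conj]
    ring
  rw [hmul]
  generalize (ψ₁ w * ψ₂ w) ^ 2 = x
  generalize spinorDensity (ψ₁ w) (ψ₂ w) * (‖ψ₂ w‖ ^ 2 - ‖ψ₁ w‖ ^ 2) = r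
  simp [div_eq_inv_mul]

theorem two_mul_sum_norm_zComp_sq :
    2 * ∑ k, ‖zComp F w k‖ ^ 2 = spinorDensity (ψ₁ w) (ψ₂ w) ^ 2 := by
  have hsum : ((2 * ∑ k, ‖zComp F w k‖ ^ 2 : ℝ) : ℂ) =
      (spinorDensity (ψ₁ w) (ψ₂ w) ^ 2 : ℝ) := by
    push_cast
    rw [ofReal_spinorDensity]
    simp only [Fin.sum_univ_three, ← Complex.mul_conj', hψ.z₁ w hw, hψ.z₂ w hw, hψ.z₃ w hw,
      Complex.star_def, map_mul, map_add, map_sub, map_pow, map_div₀, map_one, map_ofNat,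
      Complex.conj_conj, Complex.conj_I]
    linear_combination (-1 / 2 : ℂ) * ((starRingEnd ℂ (ψ₂ w) ^ 2 + ψ₁ w ^ 2) *
      (ψ₂ w ^ 2 + starRingEnd ℂ (ψ₁ w) ^ 2)) * Complex.I_sq
  exact_mod_cast hsum

theorem crossProduct_mcForm : crossProduct (mcForm F w 1) (mcForm F w Complex.I) =
    spinorDensity (ψ₁ w) (ψ₂ w) • spinorNormal (ψ₁ w) (ψ₂ w) := by
  have h₂₀ : (zComp F w 2 * star (zComp F w 0)).im = -(zComp F w 0 * star (zComp F w 2)).im := by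
    simp only [Complex.star_def, Complex.mul_im, Complex.conj_re, Complex.conj_im]
    ring
  rw [_root_.crossProduct_mcForm, h₂₀, hψ.zComp_one_mul_star_zComp_two hw,
    hψ.zComp_zero_mul_star_zComp_two hw, hψ.im_zComp_zero_mul_star_zComp_one hw]
  ext k
  fin_cases k <;>
  · simp only [Fin.zero_eta, Fin.mk_one, Fin.reduceFinMk, spinorNormal, spinorDensity,
      Pi.smul_apply, smul_eq_mul, Matrix.cons_val, ← Complex.ofReal_pow, Complex.star_def,
      Complex.mul_re, Complex.mul_im, Complex.add_re, Complex.sub_im, Complex.add_im,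
      Complex.ofReal_re, Complex.ofReal_im, Complex.conj_re, Complex.conj_im, Complex.div_ofNat_re,
      Complex.div_ofNat_im, Complex.I_re, Complex.I_im]
    ring

theorem firstForm_one_one (hF : IsConformalAt F w) :
    firstForm F w 1 1 = spinorDensity (ψ₁ w) (ψ₂ w) ^ 2 := by
  rw [hF.firstForm_one_one, hψ.two_mul_sum_norm_zComp_sq hw]

theorem spinorDensity_pos (hF : IsConformalAt F w) : 0 < spinorDensity (ψ₁ w) (ψ₂ w) := by
  refine (spinorDensity_nonneg _ _).lt_of_ne' fun hzero => hF.pos.ne' ?_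
  rw [hψ.firstForm_one_one hw hF, hzero, zero_pow two_ne_zero]

theorem unitNormal_eq (hF : IsConformalAt F w) :
    unitNormal F w = (spinorDensity (ψ₁ w) (ψ₂ w))⁻¹ • spinorNormal (ψ₁ w) (ψ₂ w) := by
  have hS := hψ.spinorDensity_pos hw hF
  have hlength : Real.sqrt (crossProduct (mcForm F w 1) (mcForm F w Complex.I) ⬝ᵥ
      crossProduct (mcForm F w 1) (mcForm F w Complex.I)) = spinorDensity (ψ₁ w) (ψ₂ w) ^ 2 := by
    rw [hψ.crossProduct_mcForm hw, smul_dotProduct, dotProduct_smul, spinorNormal_dotProduct_self,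
      smul_eq_mul, smul_eq_mul, ← mul_assoc, ← sq, ← sq, Real.sqrt_sq (sq_nonneg _)]
  simp only [unitNormal, hlength]
  rw [hψ.crossProduct_mcForm hw, smul_smul, sq, mul_inv, mul_assoc, inv_mul_cancel₀ hS.ne',
    mul_one]

end Frame

section Dirac

variable (hψ : IsGeneratingSpinor F W ψ₁ ψ₂) (hW : IsOpen W) (hw : w ∈ W)
include hψ hW hw

theorem contDiffAt_fst : ContDiffAt ℝ ∞ ψ₁ w := hψ.smooth₁.contDiffAt (hW.mem_nhds hw)

theorem contDiffAt_snd : ContDiffAt ℝ ∞ ψ₂ w := hψ.smooth₂.contDiffAt (hW.mem_nhds hw)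

theorem differentiableAt_fst : DifferentiableAt ℝ ψ₁ w :=
  (hψ.contDiffAt_fst hW hw).differentiableAt (by simp)

theorem differentiableAt_snd : DifferentiableAt ℝ ψ₂ w :=
  (hψ.contDiffAt_snd hW hw).differentiableAt (by simp)

theorem dzbar_zComp_zero : dzbar (fun u => zComp F u 0) w =
    Complex.I * (star (dz ψ₂ w * ψ₂ w) + dzbar ψ₁ w * ψ₁ w) := by
  have hψ₁ := hψ.differentiableAt_fst hW hw
  have hψ₂ : DifferentiableAt ℝ (fun u => star (ψ₂ u)) w := (hψ.differentiableAt_snd hW hw).star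
  rw [dzbar_congr (Filter.eventuallyEq_of_mem (hW.mem_nhds hw) hψ.z₁)]
  simp only [pow_two]
  rw [dzbar_const_mul _ ((hψ₂.fun_mul hψ₂).fun_add (hψ₁.fun_mul hψ₁)),
    dzbar_add (hψ₂.fun_mul hψ₂) (hψ₁.fun_mul hψ₁), dzbar_mul hψ₂ hψ₂, dzbar_mul hψ₁ hψ₁,
    dzbar_star, star_mul']
  ring

theorem dzbar_zComp_one : dzbar (fun u => zComp F u 1) w =
    star (dz ψ₂ w * ψ₂ w) - dzbar ψ₁ w * ψ₁ w := by
  have hψ₁ := hψ.differentiableAt_fst hW hw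
  have hψ₂ : DifferentiableAt ℝ (fun u => star (ψ₂ u)) w := (hψ.differentiableAt_snd hW hw).star
  rw [dzbar_congr (Filter.eventuallyEq_of_mem (hW.mem_nhds hw) hψ.z₂)]
  simp only [pow_two]
  rw [dzbar_const_mul _ ((hψ₂.fun_mul hψ₂).fun_sub (hψ₁.fun_mul hψ₁)),
    dzbar_sub (hψ₂.fun_mul hψ₂) (hψ₁.fun_mul hψ₁), dzbar_mul hψ₂ hψ₂, dzbar_mul hψ₁ hψ₁,
    dzbar_star, star_mul']
  ring

theorem dzbar_zComp_two : dzbar (fun u => zComp F u 2) w =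
    dzbar ψ₁ w * star (ψ₂ w) + ψ₁ w * star (dz ψ₂ w) := by
  rw [dzbar_congr (Filter.eventuallyEq_of_mem (hW.mem_nhds hw) hψ.z₃),
    dzbar_mul (hψ.differentiableAt_fst hW hw) (hψ.differentiableAt_snd hW hw).star, dzbar_star]

theorem dz_mul_add_dzbar_mul (hF : NilContDiffAt 2 F w) :
    dz ψ₂ w * ψ₂ w + dzbar ψ₁ w * ψ₁ w = 0 := by
  have hre := hF.im_dzbar_zComp_zero
  have him := hF.im_dzbar_zComp_one
  rw [hψ.dzbar_zComp_zero hW hw] at hre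
  rw [hψ.dzbar_zComp_one hW hw] at him
  simp only [Complex.I_mul_im, Complex.sub_im, Complex.add_re, Complex.star_def,
    Complex.conj_re, Complex.conj_im] at hre him
  apply Complex.ext
  · exact hre
  · rw [Complex.add_im, Complex.zero_im]
    linarith

theorem dz_snd_eq (hF : IsConformalAt F w) : dz ψ₂ w = -(diracPotential ψ₁ ψ₂ w * ψ₁ w) := by
  have hS : (spinorDensity (ψ₁ w) (ψ₂ w) : ℂ) ≠ 0 :=
    Complex.ofReal_ne_zero.2 (hψ.spinorDensity_pos hw hF).ne'
  rw [diracPotential]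
  field_simp
  rw [ofReal_spinorDensity]
  linear_combination star (ψ₂ w) * hψ.dz_mul_add_dzbar_mul hW hw hF.contDiffAt_two

theorem dzbar_fst_eq (hF : IsConformalAt F w) : dzbar ψ₁ w = diracPotential ψ₁ ψ₂ w * ψ₂ w := by
  have hS : (spinorDensity (ψ₁ w) (ψ₂ w) : ℂ) ≠ 0 :=
    Complex.ofReal_ne_zero.2 (hψ.spinorDensity_pos hw hF).ne'
  rw [diracPotential]
  field_simp
  rw [ofReal_spinorDensity]
  linear_combination star (ψ₁ w) * hψ.dz_mul_add_dzbar_mul hW hw hF.contDiffAt_two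

theorem dzbar_zComp_two_eq (hF : IsConformalAt F w) : dzbar (fun u => zComp F u 2) w =
    diracPotential ψ₁ ψ₂ w * ‖ψ₂ w‖ ^ 2 - star (diracPotential ψ₁ ψ₂ w) * ‖ψ₁ w‖ ^ 2 := by
  rw [hψ.dzbar_zComp_two hW hw, hψ.dz_snd_eq hW hw hF, hψ.dzbar_fst_eq hW hw hF]
  simp only [← Complex.mul_conj', Complex.star_def, map_neg, map_mul]
  ring

theorem im_diracPotential (hF : IsConformalAt F w) :
    (diracPotential ψ₁ ψ₂ w).im = (‖ψ₂ w‖ ^ 2 - ‖ψ₁ w‖ ^ 2) / 4 := by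
  have him := hF.contDiffAt_two.im_dzbar_zComp_two
  have hmul : (diracPotential ψ₁ ψ₂ w).im * (‖ψ₂ w‖ ^ 2 + ‖ψ₁ w‖ ^ 2) =
      spinorDensity (ψ₁ w) (ψ₂ w) * (‖ψ₂ w‖ ^ 2 - ‖ψ₁ w‖ ^ 2) / 4 := by
    rw [← hψ.im_zComp_zero_mul_star_zComp_one hw, ← him, hψ.dzbar_zComp_two_eq hW hw hF]
    simp only [← Complex.ofReal_pow, Complex.star_def, Complex.sub_im, Complex.im_mul_ofReal,
      Complex.conj_im]
    ring
  apply mul_left_cancel₀ (hψ.spinorDensity_pos hw hF).ne'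
  rw [spinorDensity] at hmul ⊢
  linear_combination hmul

theorem trace_covDeriv_dotProduct_spinorNormal (hF : IsConformalAt F w) :
    (covDeriv F w 1 1 + covDeriv F w Complex.I Complex.I) ⬝ᵥ spinorNormal (ψ₁ w) (ψ₂ w) =
      4 * (diracPotential ψ₁ ψ₂ w).re * spinorDensity (ψ₁ w) (ψ₂ w) ^ 2 := by
  have hZ₀ : (dzbar (fun u => zComp F u 0) w).re =
      -2 * (diracPotential ψ₁ ψ₂ w * (ψ₁ w * ψ₂ w)).im := by
    rw [hψ.dzbar_zComp_zero hW hw, hψ.dz_snd_eq hW hw hF, hψ.dzbar_fst_eq hW hw hF]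
    simp only [star_mul', star_neg, Complex.star_def, Complex.I_re, Complex.I_im, Complex.add_re,
      Complex.add_im, Complex.mul_im, Complex.mul_re, Complex.neg_re, Complex.neg_im,
      Complex.conj_re, Complex.conj_im]
    ring
  have hZ₁ : (dzbar (fun u => zComp F u 1) w).re =
      -2 * (diracPotential ψ₁ ψ₂ w * (ψ₁ w * ψ₂ w)).re := by
    rw [hψ.dzbar_zComp_one hW hw, hψ.dz_snd_eq hW hw hF, hψ.dzbar_fst_eq hW hw hF]
    simp only [star_mul', star_neg, Complex.star_def, Complex.sub_re, Complex.mul_im,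
      Complex.mul_re, Complex.neg_re, Complex.neg_im, Complex.conj_re, Complex.conj_im]
    ring
  rw [trace_covDeriv hF.contDiffAt_two, Complex.add_re, Complex.sub_re, hZ₀, hZ₁,
    hψ.dzbar_zComp_two_eq hW hw hF, hψ.zComp_one_mul_star_zComp_two hw,
    hψ.zComp_zero_mul_star_zComp_two hw, ← spinorNormal_dotProduct_self]
  simp only [spinorNormal, Matrix.vec3_dotProduct, Matrix.cons_val]
  generalize ψ₁ w * ψ₂ w = m
  simp only [← Complex.ofReal_pow, Complex.star_def, Complex.add_re, Complex.sub_re,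
    Complex.mul_re, Complex.mul_im, Complex.add_im, Complex.ofReal_re, Complex.ofReal_im,
    Complex.conj_re, Complex.conj_im, Complex.div_ofNat_re, Complex.div_ofNat_im, Complex.I_re,
    Complex.I_im]
  ring

theorem re_diracPotential (hF : IsConformalAt F w) : (diracPotential ψ₁ ψ₂ w).re =
    meanCurvature F w / 2 * spinorDensity (ψ₁ w) (ψ₂ w) := by
  have hS := hψ.spinorDensity_pos hw hF
  have hH := hF.two_mul_meanCurvature_mul
  rw [hψ.firstForm_one_one hw hF, hψ.unitNormal_eq hw hF, dotProduct_smul,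
    hψ.trace_covDeriv_dotProduct_spinorNormal hW hw hF, smul_eq_mul] at hH
  field_simp at hH ⊢
  linarith

theorem im_diracPotential_sq (hF : IsConformalAt F w) :
    (diracPotential ψ₁ ψ₂ w ^ 2).im = (dzbar (fun u => zComp F u 2) w).re / 2 := by
  rw [hψ.dzbar_zComp_two_eq hW hw hF, sq, Complex.mul_im, hψ.im_diracPotential hW hw hF]
  simp only [← Complex.ofReal_pow, Complex.star_def, Complex.sub_re, Complex.re_mul_ofReal,
    Complex.conj_re]
  ring

theorem re_diracPotential_sq (hF : IsConformalAt F w) : (diracPotential ψ₁ ψ₂ w ^ 2).re =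
    meanCurvature F w ^ 2 / 4 * (‖ψ₁ w‖ ^ 2 + ‖ψ₂ w‖ ^ 2) ^ 2 -
      1 / 16 * (‖ψ₂ w‖ ^ 2 - ‖ψ₁ w‖ ^ 2) ^ 2 := by
  rw [sq, Complex.mul_re, hψ.re_diracPotential hW hw hF, hψ.im_diracPotential hW hw hF,
    spinorDensity]
  ring

theorem continuousAt_diracPotential (hF : IsConformalAt F w) :
    ContinuousAt (diracPotential ψ₁ ψ₂) w := by
  have hψ₁ := (hψ.contDiffAt_fst hW hw).continuousAt
  have hψ₂ := (hψ.contDiffAt_snd hW hw).continuousAt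
  have hdz := (contDiffAt_dz (m := 0) (hψ.contDiffAt_snd hW hw) (by simp)).continuousAt
  have hdzbar := (contDiffAt_dzbar (m := 0) (hψ.contDiffAt_fst hW hw) (by simp)).continuousAt
  have hS : ContinuousAt (fun u => (spinorDensity (ψ₁ u) (ψ₂ u) : ℂ)) w := by
    simp only [ofReal_spinorDensity]
    exact (hψ₁.mul hψ₁.star).add (hψ₂.mul hψ₂.star)
  exact ((hdzbar.mul hψ₂.star).sub (hdz.mul hψ₁.star)).div hS
    (Complex.ofReal_ne_zero.2 (hψ.spinorDensity_pos hw hF).ne')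

end Dirac

end IsGeneratingSpinor

/-! ### Uniqueness of the potentials and change of parameter -/

namespace IsGeneratingSpinor

variable {F : ℂ → Nil} {W W' : Set ℂ} {ψ₁ ψ₂ χ₁ χ₂ : ℂ → ℂ} {w : ℂ}

theorem isDiracPotential (hψ : IsGeneratingSpinor F W ψ₁ ψ₂) (hW : IsOpen W)
    (hF : ∀ u ∈ W, IsConformalAt F u) :
    IsDiracPotential W ψ₁ ψ₂ (diracPotential ψ₁ ψ₂) (diracPotential ψ₁ ψ₂) where
  continuous_U u hu := (hψ.continuousAt_diracPotential hW hu (hF u hu)).continuousWithinAt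
  continuous_V u hu := (hψ.continuousAt_diracPotential hW hu (hF u hu)).continuousWithinAt
  dirac₁ u hu := by rw [hψ.dz_snd_eq hW hu (hF u hu), neg_add_cancel]
  dirac₂ u hu := by rw [hψ.dzbar_fst_eq hW hu (hF u hu), neg_add_cancel]

section Uniqueness

variable (hψ : IsGeneratingSpinor F W ψ₁ ψ₂) (hW : IsOpen W) (hw : w ∈ W)
include hψ hW hw

-- The imaginary part of the potential comes from the noncommutativity of Nil; it is what keeps a
-- component of the spinor from vanishing on an open set and so makes the potentials unique.
theorem diracPotential_ne_zero_of_mul_eq_zero (hF : IsConformalAt F w)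
    (h : ψ₁ w * ψ₂ w = 0) : diracPotential ψ₁ ψ₂ w ≠ 0 := by
  intro hP
  have him := hψ.im_diracPotential hW hw hF
  have hS := hψ.spinorDensity_pos hw hF
  rw [hP, Complex.zero_im] at him
  rw [spinorDensity] at hS
  rcases mul_eq_zero.1 h with h | h <;> rw [h, norm_zero] at him hS <;> linarith

theorem frequently_fst_ne_zero (hF : IsConformalAt F w) : ∃ᶠ u in nhds w, ψ₁ u ≠ 0 := by
  intro hzero
  have hψ₁ : ψ₁ =ᶠ[nhds w] fun _ => 0 := hzero.mono fun u hu => not_not.1 hu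
  have hP := hψ.diracPotential_ne_zero_of_mul_eq_zero hW hw hF (by simp [hψ₁.self_of_nhds])
  have hS := hψ.spinorDensity_pos hw hF
  have hψ₂ : diracPotential ψ₁ ψ₂ w * ψ₂ w = 0 := by
    rw [← hψ.dzbar_fst_eq hW hw hF, dzbar_congr hψ₁, dzbar_eq_zero (differentiableAt_const _)]
  rw [spinorDensity, hψ₁.self_of_nhds, (mul_eq_zero.1 hψ₂).resolve_left hP] at hS
  simp at hS

theorem frequently_snd_ne_zero (hF : IsConformalAt F w) : ∃ᶠ u in nhds w, ψ₂ u ≠ 0 := by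
  intro hzero
  have hψ₂ : ψ₂ =ᶠ[nhds w] fun _ => 0 := hzero.mono fun u hu => not_not.1 hu
  have hP := hψ.diracPotential_ne_zero_of_mul_eq_zero hW hw hF (by simp [hψ₂.self_of_nhds])
  have hS := hψ.spinorDensity_pos hw hF
  have hψ₁ : diracPotential ψ₁ ψ₂ w * ψ₁ w = 0 := by
    rw [← neg_eq_zero, ← hψ.dz_snd_eq hW hw hF, dz_congr hψ₂,
      dz_eq_deriv (differentiableAt_const _), deriv_const]
  rw [spinorDensity, hψ₂.self_of_nhds, (mul_eq_zero.1 hψ₁).resolve_left hP] at hS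
  simp at hS

theorem fst_potential_eq (hF : ∀ u ∈ W, IsConformalAt F u) {U V : ℂ → ℂ}
    (hUV : IsDiracPotential W ψ₁ ψ₂ U V) : U w = diracPotential ψ₁ ψ₂ w := by
  refine tendsto_nhds_unique_of_frequently_eq (hUV.continuous_U.continuousAt (hW.mem_nhds hw))
    (hψ.continuousAt_diracPotential hW hw (hF w hw)) ?_
  refine ((hψ.frequently_fst_ne_zero hW hw (hF w hw)).and_eventually (hW.mem_nhds hw)).mono ?_
  rintro u ⟨hu, huW⟩
  have hdirac := hUV.dirac₁ u huW
  rw [hψ.dz_snd_eq hW huW (hF u huW), neg_add_eq_zero] at hdirac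
  exact (mul_right_cancel₀ hu hdirac).symm

theorem snd_potential_eq (hF : ∀ u ∈ W, IsConformalAt F u) {U V : ℂ → ℂ}
    (hUV : IsDiracPotential W ψ₁ ψ₂ U V) : V w = diracPotential ψ₁ ψ₂ w := by
  refine tendsto_nhds_unique_of_frequently_eq (hUV.continuous_V.continuousAt (hW.mem_nhds hw))
    (hψ.continuousAt_diracPotential hW hw (hF w hw)) ?_
  refine ((hψ.frequently_snd_ne_zero hW hw (hF w hw)).and_eventually (hW.mem_nhds hw)).mono ?_
  rintro u ⟨hu, huW⟩
  have hdirac := hUV.dirac₂ u huW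
  rw [hψ.dzbar_fst_eq hW huW (hF u huW), neg_add_eq_zero] at hdirac
  exact (mul_right_cancel₀ hu hdirac).symm

theorem diracPotential_sq_eq (hF : IsConformalAt F w) (hχ : IsGeneratingSpinor F W' χ₁ χ₂)
    (hW' : IsOpen W') (hw' : w ∈ W') : diracPotential ψ₁ ψ₂ w ^ 2 = diracPotential χ₁ χ₂ w ^ 2 := by
  apply Complex.ext
  · rw [hψ.re_diracPotential_sq hW hw hF, hχ.re_diracPotential_sq hW' hw' hF, hψ.norm_sq_fst hw,
      hψ.norm_sq_snd hw, hχ.norm_sq_fst hw', hχ.norm_sq_snd hw']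
  · rw [hψ.im_diracPotential_sq hW hw hF, hχ.im_diracPotential_sq hW' hw' hF]

end Uniqueness

end IsGeneratingSpinor

section ChangeOfParameter

variable {F G : ℂ → Nil} {T W : Set ℂ} {ψ₁ ψ₂ τ s : ℂ → ℂ}

theorem IsGeneratingSpinor.comp_mul (hψ : IsGeneratingSpinor F W ψ₁ ψ₂)
    (hτ : ContDiffOn ℝ ∞ τ T) (hs : ContDiffOn ℝ ∞ s T) (hτT : Set.MapsTo τ T W)
    (hG : ∀ u ∈ T, ∀ k, zComp G u k = zComp F (τ u) k * s u ^ 2) :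
    IsGeneratingSpinor G T (fun u => ψ₁ (τ u) * s u) (fun u => ψ₂ (τ u) * star (s u)) where
  smooth₁ := (hψ.smooth₁.comp hτ hτT).mul hs
  smooth₂ := (hψ.smooth₂.comp hτ hτT).mul (Complex.conjCLE.contDiff.comp_contDiffOn hs)
  z₁ u hu := by rw [hG u hu, hψ.z₁ _ (hτT hu), star_mul', star_star]; ring
  z₂ u hu := by rw [hG u hu, hψ.z₂ _ (hτT hu), star_mul', star_star]; ring
  z₃ u hu := by rw [hG u hu, hψ.z₃ _ (hτT hu), star_mul', star_star]; ring

theorem IsDiracPotential.comp_mul {U V : ℂ → ℂ} (hUV : IsDiracPotential W ψ₁ ψ₂ U V)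
    (hψ₁ : ∀ u ∈ W, DifferentiableAt ℝ ψ₁ u) (hψ₂ : ∀ u ∈ W, DifferentiableAt ℝ ψ₂ u)
    (hτ : ∀ u ∈ T, DifferentiableAt ℂ τ u) (hs : ∀ u ∈ T, DifferentiableAt ℂ s u)
    (hτT : Set.MapsTo τ T W) (hsq : ∀ u ∈ T, s u ^ 2 = deriv τ u) :
    IsDiracPotential T (fun u => ψ₁ (τ u) * s u) (fun u => ψ₂ (τ u) * star (s u))
      (fun u => ‖s u‖ ^ 2 * U (τ u)) (fun u => ‖s u‖ ^ 2 * V (τ u)) := by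
  have hτc : ContinuousOn τ T := fun u hu => (hτ u hu).continuousAt.continuousWithinAt
  have hsc : ContinuousOn (fun u => (‖s u‖ : ℂ) ^ 2) T := fun u hu =>
    (Complex.continuous_ofReal.continuousAt.comp
      (hs u hu).continuousAt.norm).continuousWithinAt.pow 2
  refine ⟨hsc.mul (hUV.continuous_U.comp hτc hτT), hsc.mul (hUV.continuous_V.comp hτc hτT),
    fun u hu => ?_, fun u hu => ?_⟩
  · have hψτ := (hψ₂ _ (hτT hu)).comp u ((hτ u hu).restrictScalars ℝ)
    have hdz : dz ψ₂ (τ u) = -(U (τ u) * ψ₁ (τ u)) :=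
      eq_neg_of_add_eq_zero_left (hUV.dirac₁ _ (hτT hu))
    rw [dz_mul (g := fun u => ψ₂ (τ u)) hψτ ((hs u hu).restrictScalars ℝ).star,
      dz_comp_holomorphic (hψ₂ _ (hτT hu)) (hτ u hu), dz_star, dzbar_eq_zero (hs u hu), ← hsq u hu,
      hdz, ← Complex.mul_conj', Complex.star_def, map_zero]
    ring
  · have hψτ := (hψ₁ _ (hτT hu)).comp u ((hτ u hu).restrictScalars ℝ)
    have hdzbar : dzbar ψ₁ (τ u) = V (τ u) * ψ₂ (τ u) :=
      neg_add_eq_zero.1 (hUV.dirac₂ _ (hτT hu))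
    rw [dzbar_mul (g := fun u => ψ₁ (τ u)) hψτ ((hs u hu).restrictScalars ℝ),
      dzbar_comp_holomorphic (hψ₁ _ (hτT hu)) (hτ u hu), dzbar_eq_zero (hs u hu), ← hsq u hu,
      hdzbar, ← Complex.mul_conj', star_pow, Complex.star_def]
    ring

end ChangeOfParameter

/-! ### Conformal immersions of a surface -/

section RestrictScalars

variable {𝕜 𝕜' E : Type*} [NontriviallyNormedField 𝕜] [NontriviallyNormedField 𝕜']
  [NormedAlgebra 𝕜 𝕜'] [NormedAddCommGroup E] [NormedSpace 𝕜 E] [NormedSpace 𝕜' E]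
  [IsScalarTower 𝕜 𝕜' E] {m n : WithTop ℕ∞}
  {M : Type*} [TopologicalSpace M] [ChartedSpace E M]

variable (𝕜 𝕜' E) in
theorem contDiffGroupoid_le_restrictScalars (hmn : m ≤ n) :
    contDiffGroupoid n 𝓘(𝕜', E) ≤ contDiffGroupoid m 𝓘(𝕜, E) := by
  refine groupoid_of_pregroupoid_le _ _ fun g s hg => ?_
  simp only [contDiffPregroupoid, modelWithCornersSelf_coe, modelWithCornersSelf_coe_symm,
    Function.id_comp, Function.comp_id, Set.preimage_id, Set.range_id, Set.inter_univ] at hg ⊢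
  exact (hg.restrict_scalars 𝕜).of_le hmn

variable (𝕜) in
theorem mem_maximalAtlas_restrictScalars (hmn : m ≤ n) {φ : OpenPartialHomeomorph M E}
    (hφ : φ ∈ IsManifold.maximalAtlas 𝓘(𝕜', E) n M) :
    φ ∈ IsManifold.maximalAtlas 𝓘(𝕜, E) m M := fun e he =>
  ⟨contDiffGroupoid_le_restrictScalars 𝕜 𝕜' E hmn (hφ e he).1,
    contDiffGroupoid_le_restrictScalars 𝕜 𝕜' E hmn (hφ e he).2⟩

variable (𝕜 𝕜' E M) in
theorem isManifold_restrictScalars [IsManifold 𝓘(𝕜', E) n M] (hmn : m ≤ n) :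
    IsManifold 𝓘(𝕜, E) m M where
  compatible he he' := contDiffGroupoid_le_restrictScalars 𝕜 𝕜' E hmn
    (HasGroupoid.compatible (G := contDiffGroupoid n 𝓘(𝕜', E)) he he')

end RestrictScalars

section Transition

theorem comp_symm_eventuallyEq {M X Y : Type*} [TopologicalSpace M] [TopologicalSpace Y]
    {φ χ : OpenPartialHomeomorph M Y} {w : Y} (f : M → X) (hw : w ∈ (φ.symm.trans χ).source) :
    f ∘ φ.symm =ᶠ[nhds w] (f ∘ χ.symm) ∘ (χ ∘ φ.symm) := by
  filter_upwards [(φ.symm.trans χ).open_source.mem_nhds hw] with u hu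
  simp only [Function.comp_apply, χ.left_inv (show φ.symm u ∈ χ.source from hu.2)]

theorem deriv_ne_zero_of_eventually_leftInverse {𝕜 : Type*} [NontriviallyNormedField 𝕜]
    {g h : 𝕜 → 𝕜} {w : 𝕜} (hh : DifferentiableAt 𝕜 h (g w)) (hg : DifferentiableAt 𝕜 g w)
    (hinv : ∀ᶠ u in nhds w, h (g u) = u) : deriv g w ≠ 0 := by
  intro hzero
  have hderiv : deriv (h ∘ g) w = 1 := by
    rw [Filter.EventuallyEq.deriv_eq (show h ∘ g =ᶠ[nhds w] id from hinv), deriv_id]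
  rw [deriv_comp w hh hg, hzero, mul_zero] at hderiv
  exact zero_ne_one hderiv

variable {𝕜 M : Type*} [NontriviallyNormedField 𝕜] [TopologicalSpace M] [ChartedSpace 𝕜 M]
  {n : WithTop ℕ∞} {φ χ : OpenPartialHomeomorph M 𝕜} {w : 𝕜}

theorem contDiffAt_transition (hφ : φ ∈ IsManifold.maximalAtlas 𝓘(𝕜) n M)
    (hχ : χ ∈ IsManifold.maximalAtlas 𝓘(𝕜) n M) (hw : w ∈ (φ.symm.trans χ).source) :
    ContDiffAt 𝕜 n (χ ∘ φ.symm) w :=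
  (contMDiffOn_of_mem_contDiffGroupoid
    (IsManifold.compatible_of_mem_maximalAtlas hφ hχ)).contDiffOn.contDiffAt
    ((φ.symm.trans χ).open_source.mem_nhds hw)

theorem deriv_transition_ne_zero (hn : n ≠ 0) (hφ : φ ∈ IsManifold.maximalAtlas 𝓘(𝕜) n M)
    (hχ : χ ∈ IsManifold.maximalAtlas 𝓘(𝕜) n M) (hw : w ∈ (φ.symm.trans χ).source) :
    deriv (χ ∘ φ.symm) w ≠ 0 := by
  have hw' : (χ ∘ φ.symm) w ∈ (χ.symm.trans φ).source := by
    simpa using (φ.symm.trans χ).map_source hw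
  refine deriv_ne_zero_of_eventually_leftInverse
    ((contDiffAt_transition hχ hφ hw').differentiableAt hn)
    ((contDiffAt_transition hφ hχ hw).differentiableAt hn) ?_
  filter_upwards [(φ.symm.trans χ).eventually_left_inverse hw] with u hu
  simpa using hu

end Transition

section Surface

variable {M : Type*} [TopologicalSpace M] [ChartedSpace ℂ M] {f : M → Nil}
  {φ χ : OpenPartialHomeomorph M ℂ} {w : ℂ}

theorem IsConformalImmersion.isConformalAt (hf : IsConformalImmersion f)
    (hφ : φ ∈ IsManifold.maximalAtlas 𝓘(ℂ) ω M) (hw : w ∈ φ.target) :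
    IsConformalAt (f ∘ φ.symm) w := by
  have hφ' := contMDiffOn_symm_of_mem_maximalAtlas
    (mem_maximalAtlas_restrictScalars ℝ (m := ∞) le_top hφ)
  have hsmooth {g : M → ℝ} (hg : ContMDiff 𝓘(ℝ, ℂ) 𝓘(ℝ, ℝ) ∞ g) :
      ContDiffAt ℝ ∞ (g ∘ φ.symm) w :=
    (hg.comp_contMDiffOn hφ').contDiffOn.contDiffAt (φ.open_target.mem_nhds hw)
  obtain ⟨hpos, heq, horth⟩ := hf.conformal φ hφ w hw
  exact ⟨⟨hsmooth hf.smooth_x, hsmooth hf.smooth_y, hsmooth hf.smooth_z⟩, hpos, heq, horth⟩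

theorem IsConformalImmersion.zComp_transition (hf : IsConformalImmersion f)
    (hφ : φ ∈ IsManifold.maximalAtlas 𝓘(ℂ) ω M) (hχ : χ ∈ IsManifold.maximalAtlas 𝓘(ℂ) ω M)
    (hw : w ∈ (φ.symm.trans χ).source) (k : Fin 3) :
    zComp (f ∘ φ.symm) w k =
      zComp (f ∘ χ.symm) ((χ ∘ φ.symm) w) k * deriv (χ ∘ φ.symm) w := by
  rw [zComp_congr (comp_symm_eventuallyEq f hw)]
  exact ((hf.isConformalAt hχ (χ.map_source hw.2)).smooth.of_le (by simp)).zComp_comp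
    ((contDiffAt_transition hφ hχ hw).differentiableAt (by simp)) k

theorem IsConformalImmersion.isEnergyCoeff_iff (hf : IsConformalImmersion f)
    (hφ : φ ∈ IsManifold.maximalAtlas 𝓘(ℂ) ω M) {W : Set ℂ} {ψ₁ ψ₂ : ℂ → ℂ} (hW : IsOpen W)
    (hWφ : W ⊆ φ.target) (hψ : IsGeneratingSpinor (f ∘ φ.symm) W ψ₁ ψ₂) (hw : w ∈ W) (c : ℂ) :
    IsEnergyCoeff f φ w c ↔ c = diracPotential ψ₁ ψ₂ w ^ 2 := by
  constructor
  · rintro ⟨W', χ₁, χ₂, U, V, hW', hw', hW'φ, hχ, hUV, rfl⟩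
    have hF : ∀ u ∈ W', IsConformalAt (f ∘ φ.symm) u := fun u hu =>
      hf.isConformalAt hφ (hW'φ hu)
    rw [hχ.fst_potential_eq hW' hw' hF hUV, hχ.snd_potential_eq hW' hw' hF hUV, ← sq]
    exact hχ.diracPotential_sq_eq hW' hw' (hF w hw') hψ hW hw
  · rintro rfl
    exact ⟨W, ψ₁, ψ₂, _, _, hW, hw, hWφ, hψ,
      hψ.isDiracPotential hW fun u hu => hf.isConformalAt hφ (hWφ hu), sq _⟩

namespace IsConformalImmersion

variable (hf : IsConformalImmersion f) (hφ : φ ∈ IsManifold.maximalAtlas 𝓘(ℂ) ω M)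
include hf hφ

theorem exists_isGeneratingSpinor (hw : w ∈ φ.target) :
    ∃ W ⊆ φ.target, IsOpen W ∧ w ∈ W ∧ ∃ ψ₁ ψ₂, IsGeneratingSpinor (f ∘ φ.symm) W ψ₁ ψ₂ :=
  _root_.exists_isGeneratingSpinor (fun _ hu => hf.isConformalAt hφ hu) φ.open_target hw

theorem existsUnique_isEnergyCoeff (hw : w ∈ φ.target) : ∃! c, IsEnergyCoeff f φ w c := by
  obtain ⟨W, hWφ, hW, hwW, ψ₁, ψ₂, hψ⟩ := hf.exists_isGeneratingSpinor hφ hw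
  simp only [hf.isEnergyCoeff_iff hφ hW hWφ hψ hwW]
  exact existsUnique_eq

theorem isEnergyCoeff_energyCoeff (hw : w ∈ φ.target) :
    IsEnergyCoeff f φ w (energyCoeff f φ w) :=
  Classical.epsilon_spec (hf.existsUnique_isEnergyCoeff hφ hw).exists

theorem energyCoeff_eq {W : Set ℂ} {ψ₁ ψ₂ : ℂ → ℂ} (hW : IsOpen W) (hWφ : W ⊆ φ.target)
    (hψ : IsGeneratingSpinor (f ∘ φ.symm) W ψ₁ ψ₂) (hw : w ∈ W) :
    energyCoeff f φ w = diracPotential ψ₁ ψ₂ w ^ 2 :=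
  (hf.isEnergyCoeff_iff hφ hW hWφ hψ hw _).1 (hf.isEnergyCoeff_energyCoeff hφ (hWφ hw))

theorem continuousOn_energyCoeff : ContinuousOn (energyCoeff f φ) φ.target := by
  intro w hw
  obtain ⟨W, hWφ, hW, hwW, ψ₁, ψ₂, hψ⟩ := hf.exists_isGeneratingSpinor hφ hw
  have hP := (hψ.continuousAt_diracPotential hW hwW (hf.isConformalAt hφ hw)).pow 2
  refine (hP.congr ?_).continuousWithinAt
  filter_upwards [hW.mem_nhds hwW] with u hu using (hf.energyCoeff_eq hφ hW hWφ hψ hu).symm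

theorem im_energyCoeff (hw : w ∈ φ.target) :
    (energyCoeff f φ w).im = (dzbar (fun u => zComp (f ∘ φ.symm) u 2) w).re / 2 := by
  obtain ⟨W, hWφ, hW, hwW, ψ₁, ψ₂, hψ⟩ := hf.exists_isGeneratingSpinor hφ hw
  rw [hf.energyCoeff_eq hφ hW hWφ hψ hwW,
    hψ.im_diracPotential_sq hW hwW (hf.isConformalAt hφ hw)]

theorem re_energyCoeff (hw : w ∈ φ.target) :
    (energyCoeff f φ w).re = meanCurvature (f ∘ φ.symm) w ^ 2 / 4 *
        (‖(spinorAt f φ w).1‖ ^ 2 + ‖(spinorAt f φ w).2‖ ^ 2) ^ 2 -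
      1 / 16 * (‖(spinorAt f φ w).2‖ ^ 2 - ‖(spinorAt f φ w).1‖ ^ 2) ^ 2 := by
  have hspinorAt : ∃ (W : Set ℂ) (ψ₁ ψ₂ : ℂ → ℂ), IsOpen W ∧ w ∈ W ∧ W ⊆ φ.target ∧
      IsGeneratingSpinor (f ∘ φ.symm) W ψ₁ ψ₂ ∧ spinorAt f φ w = (ψ₁ w, ψ₂ w) := by
    obtain ⟨W, hWφ, hW, hwW, ψ₁, ψ₂, hψ⟩ := hf.exists_isGeneratingSpinor hφ hw
    exact Classical.epsilon_spec (p := fun s => ∃ (W : Set ℂ) (ψ₁ ψ₂ : ℂ → ℂ), IsOpen W ∧ w ∈ W ∧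
      W ⊆ φ.target ∧ IsGeneratingSpinor (f ∘ φ.symm) W ψ₁ ψ₂ ∧ s = (ψ₁ w, ψ₂ w))
      ⟨_, W, ψ₁, ψ₂, hW, hwW, hWφ, hψ, rfl⟩
  obtain ⟨W, ψ₁, ψ₂, hW, hwW, hWφ, hψ, hvalue⟩ := hspinorAt
  rw [hf.energyCoeff_eq hφ hW hWφ hψ hwW, hvalue,
    hψ.re_diracPotential_sq hW hwW (hf.isConformalAt hφ hw)]

theorem isEnergyCoeff_transition (hχ : χ ∈ IsManifold.maximalAtlas 𝓘(ℂ) ω M)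
    (hw : w ∈ (φ.symm.trans χ).source) {c : ℂ} (hc : IsEnergyCoeff f χ ((χ ∘ φ.symm) w) c) :
    IsEnergyCoeff f φ w ((‖deriv (χ ∘ φ.symm) w‖ : ℂ) ^ 2 * c) := by
  obtain ⟨W, ψ₁, ψ₂, U, V, hW, hwW, -, hψ, hUV, rfl⟩ := hc
  have hS : IsOpen (φ.symm.trans χ).source := (φ.symm.trans χ).open_source
  have hτ : ContDiffOn ℂ ω (χ ∘ φ.symm) (φ.symm.trans χ).source := fun u hu =>
    (contDiffAt_transition hφ hχ hu).contDiffWithinAt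
  have hτ' : ContDiffOn ℂ ω (deriv (χ ∘ φ.symm)) (φ.symm.trans χ).source :=
    ((hτ.differentiableOn (by simp)).deriv hS).contDiffOn hS
  -- A spinor is a half-density: it is pulled back with a square root `s` of the derivative.
  obtain ⟨S, hSsub, hSopen, hwS, s, hs, hsq⟩ := exists_contDiffOn_sq_eq hτ'
    hS hw (deriv_transition_ne_zero (by simp) hφ hχ hw)
  set τ := χ ∘ φ.symm
  set T := S ∩ τ ⁻¹' W
  have hT : IsOpen T := (hτ.mono hSsub).continuousOn.isOpen_inter_preimage hSopen hW
  have hTS {u : ℂ} (hu : u ∈ T) : u ∈ (φ.symm.trans χ).source := hSsub hu.1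
  have hτT : ContDiffOn ℂ ω τ T := hτ.mono fun _ hu => hTS hu
  have hsT : ContDiffOn ℂ ω s T := hs.mono Set.inter_subset_left
  refine ⟨T, _, _, _, _, hT, ⟨hwS, hwW⟩, fun u hu => (hTS hu).1,
    hψ.comp_mul ((hτT.restrict_scalars ℝ).of_le le_top) ((hsT.restrict_scalars ℝ).of_le le_top)
      (fun _ hu => hu.2) fun u hu k => ?_,
    hUV.comp_mul (fun u hu => hψ.differentiableAt_fst hW hu)
      (fun u hu => hψ.differentiableAt_snd hW hu)
      (fun u hu => (hτT.differentiableOn (by simp)).differentiableAt (hT.mem_nhds hu))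
      (fun u hu => (hsT.differentiableOn (by simp)).differentiableAt (hT.mem_nhds hu))
      (fun _ hu => hu.2) fun u hu => (hsq u hu.1).2, ?_⟩
  · rw [hf.zComp_transition hφ hχ (hTS hu), (hsq u hu.1).2]
  · rw [← (hsq w hwS).2, norm_pow]
    push_cast
    ring

theorem energyCoeff_transition (hχ : χ ∈ IsManifold.maximalAtlas 𝓘(ℂ) ω M)
    (hw : w ∈ (φ.symm.trans χ).source) :
    energyCoeff f φ w =
      (‖deriv (χ ∘ φ.symm) w‖ : ℂ) ^ 2 * energyCoeff f χ ((χ ∘ φ.symm) w) :=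
  (hf.existsUnique_isEnergyCoeff hφ hw.1).unique (hf.isEnergyCoeff_energyCoeff hφ hw.1)
    (hf.isEnergyCoeff_transition hφ hχ hw
      (hf.isEnergyCoeff_energyCoeff hχ (χ.map_source hw.2)))

end IsConformalImmersion

end Surface

/-! ### Integration by parts in the plane -/

open MeasureTheory

theorem dzbar_sum {ι : Type*} {s : Finset ι} {g : ι → ℂ → ℂ} {w : ℂ}
    (hg : ∀ i ∈ s, DifferentiableAt ℝ (g i) w) :
    dzbar (fun u => ∑ i ∈ s, g i u) w = ∑ i ∈ s, dzbar (g i) w := by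
  simp only [dzbar, fderiv_fun_sum hg, _root_.sum_apply, Finset.mul_sum,
    ← Finset.sum_add_distrib, Finset.sum_div]

theorem det_fderiv_real_eq_norm_deriv_sq {τ : ℂ → ℂ} {w : ℂ} (hτ : DifferentiableAt ℂ τ w) :
    (fderiv ℝ τ w).det = ‖deriv τ w‖ ^ 2 := by
  have hmul : (fderiv ℝ τ w : ℂ →ₗ[ℝ] ℂ) =
      (LinearMap.mulLeft ℂ (deriv τ w)).restrictScalars ℝ := by
    rw [hτ.fderiv_restrictScalars ℝ]
    refine LinearMap.ext fun v => ?_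
    simp [mul_comm]
  rw [ContinuousLinearMap.det, hmul, LinearMap.det_restrictScalars, Algebra.norm_complex_apply,
    Complex.normSq_eq_norm_sq, LinearMap.det_ring, LinearMap.mulLeft_apply, mul_one]

theorem integrableOn_of_eq_zero_off_compact {X E : Type*} [TopologicalSpace X] [T2Space X]
    [MeasurableSpace X] [OpensMeasurableSpace X] [NormedAddCommGroup E] {μ : Measure X}
    [IsFiniteMeasureOnCompacts μ] {h : X → E} {T K : Set X} (hh : ContinuousOn h K)
    (hT : MeasurableSet T) (hK : IsCompact K) (hzero : ∀ x ∈ T \ K, h x = 0) :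
    IntegrableOn h T μ :=
  (hh.integrableOn_compact hK).of_forall_sdiff_eq_zero hT hzero

theorem support_indicator_subset {X E : Type*} [Zero E] {g : X → E} {T K : Set X}
    (hzero : ∀ x ∈ T \ K, g x = 0) : Function.support (T.indicator g) ⊆ K := by
  intro x hx
  rw [Set.support_indicator] at hx
  exact by_contra fun hxK => hx.2 (hzero x ⟨hx.1, hxK⟩)

theorem contDiff_indicator {𝕜 E F : Type*} [NontriviallyNormedField 𝕜] [NormedAddCommGroup E]
    [NormedSpace 𝕜 E] [NormedAddCommGroup F] [NormedSpace 𝕜 F] {n : WithTop ℕ∞} {g : E → F}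
    {T K : Set E} (hg : ContDiffOn 𝕜 n g T) (hT : IsOpen T) (hK : IsClosed K) (hKT : K ⊆ T)
    (hzero : ∀ x ∈ T \ K, g x = 0) : ContDiff 𝕜 n (T.indicator g) := by
  refine contMDiff_iff_contDiff.1 (contMDiff_of_tsupport fun x hx => ?_)
  have hxT : T ∈ nhds x :=
    hT.mem_nhds (hKT (closure_minimal (support_indicator_subset hzero) hK hx))
  refine ((hg.contDiffAt hxT).congr_of_eventuallyEq ?_).contMDiffAt
  filter_upwards [hxT] with u hu using Set.indicator_of_mem hu g

section Fderiv

variable {E F : Type*} [NormedAddCommGroup E] [NormedSpace ℝ E] [MeasurableSpace E]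
  [BorelSpace E] {μ : Measure E} [NormedAddCommGroup F] [NormedSpace ℝ F]
  {g : E → F}

theorem integrable_fderiv_apply [IsFiniteMeasureOnCompacts μ] (hg : ContDiff ℝ 1 g)
    (hc : HasCompactSupport g) (v : E) : Integrable (fun w => fderiv ℝ g w v) μ :=
  ((hg.continuous_fderiv one_ne_zero).clm_apply
    continuous_const).integrable_of_hasCompactSupport (hc.fderiv_apply ℝ v)

theorem integral_fderiv_apply_eq_zero [FiniteDimensional ℝ E] [μ.IsAddHaarMeasure]
    (hg : ContDiff ℝ 1 g) (hc : HasCompactSupport g) (v : E) : ∫ w, fderiv ℝ g w v ∂μ = 0 := by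
  have hparts := integral_bilinear_fderiv_right_eq_neg_left_of_integrable (μ := μ)
    (B := ContinuousLinearMap.lsmul ℝ ℝ) (f := fun _ : E => (1 : ℝ)) (g := g) (v := v)
    (by simp) (by simpa using integrable_fderiv_apply hg hc v)
    (by simpa using hg.continuous.integrable_of_hasCompactSupport hc)
    (fun _ _ => differentiableAt_const _) fun w _ => hg.differentiable one_ne_zero w
  simpa using hparts

end Fderiv

theorem integral_dzbar_eq_zero {g : ℂ → ℂ} (hg : ContDiff ℝ 1 g) (hc : HasCompactSupport g) :
    ∫ w, dzbar g w = 0 := by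
  simp only [dzbar]
  rw [integral_div, integral_add (integrable_fderiv_apply hg hc 1)
      ((integrable_fderiv_apply hg hc Complex.I).const_mul _), integral_const_mul,
    integral_fderiv_apply_eq_zero hg hc, integral_fderiv_apply_eq_zero hg hc, mul_zero,
    add_zero, zero_div]

theorem setIntegral_dzbar_eq_zero {g : ℂ → ℂ} {T K : Set ℂ} (hg : ContDiffOn ℝ 1 g T)
    (hT : IsOpen T) (hK : IsCompact K) (hKT : K ⊆ T) (hzero : ∀ w ∈ T \ K, g w = 0) :
    ∫ w in T, dzbar g w = 0 := by
  have hsupp : Function.support (T.indicator g) ⊆ K := support_indicator_subset hzero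
  have hoff (w : ℂ) (hw : w ∉ T) : dzbar (T.indicator g) w = 0 := by
    have hev : T.indicator g =ᶠ[nhds w] fun _ => 0 :=
      notMem_tsupport_iff_eventuallyEq.1 fun h => hw (hKT (closure_minimal hsupp hK.isClosed h))
    rw [dzbar_congr hev, dzbar_eq_zero (differentiableAt_const 0)]
  calc ∫ w in T, dzbar g w = ∫ w in T, dzbar (T.indicator g) w :=
        setIntegral_congr_fun hT.measurableSet fun w hw => dzbar_congr <| by
          filter_upwards [hT.mem_nhds hw] with u hu using (Set.indicator_of_mem hu g).symm
    _ = ∫ w, dzbar (T.indicator g) w := setIntegral_eq_integral_of_forall_compl_eq_zero hoff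
    _ = 0 := integral_dzbar_eq_zero (contDiff_indicator hg hT hK.isClosed hKT hzero)
        (HasCompactSupport.of_support_subset_isCompact hK hsupp)

theorem exists_finset_eq_zero_and_sum_eq_one {ι X : Type*} [TopologicalSpace X] [CompactSpace X]
    (ρ : PartitionOfUnity ι X Set.univ) :
    ∃ t : Finset ι, (∀ i ∉ t, ρ i = 0) ∧ ∀ x, ∑ i ∈ t, ρ i x = 1 := by
  have hfin := ρ.locallyFinite.finite_nonempty_of_compact
  have hzero : ∀ i ∉ hfin.toFinset, ρ i = 0 := fun i hi => by
    rw [hfin.mem_toFinset, Set.mem_ofPred_eq, Set.not_nonempty_iff_eq_empty,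
      Function.support_eq_empty_iff] at hi
    exact DFunLike.coe_injective hi
  refine ⟨hfin.toFinset, hzero, fun x => ρ.sum_finsupport' (Set.mem_univ x) fun i hi => ?_⟩
  by_contra hit
  exact (ρ.mem_finsupport x).1 hi (DFunLike.congr_fun (hzero i hit) x)

/-! ### Integration over the surface -/

theorem integrableOn_target_of_eq_zero {X Y E : Type*} [TopologicalSpace X] [CompactSpace X]
    [TopologicalSpace Y] [T2Space Y] [MeasurableSpace Y] [OpensMeasurableSpace Y]
    [NormedAddCommGroup E] {μ : Measure Y} [IsFiniteMeasureOnCompacts μ]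
    {φ : OpenPartialHomeomorph X Y} {K : Set X} (hK : IsClosed K) (hKφ : K ⊆ φ.source)
    {h : Y → E} (hh : ContinuousOn h φ.target)
    (hzero : ∀ w ∈ φ.target, φ.symm w ∉ K → h w = 0) : IntegrableOn h φ.target μ :=
  integrableOn_of_eq_zero_off_compact (hh.mono (φ.mapsTo.mono_left hKφ).image_subset)
    φ.open_target.measurableSet (hK.isCompact.image_of_continuousOn (φ.continuousOn.mono hKφ))
    fun w hw => hzero w hw.1 fun hwK => hw.2 ⟨_, hwK, φ.right_inv hw.1⟩

section Surface

variable {M : Type*} [TopologicalSpace M] [ChartedSpace ℂ M]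
  {φ χ : OpenPartialHomeomorph M ℂ} {c : OpenPartialHomeomorph M ℂ → ℂ → ℂ}

theorem setIntegral_target_eq {E : Type*} [NormedAddCommGroup E] [NormedSpace ℝ E]
    (hφ : φ ∈ IsManifold.maximalAtlas 𝓘(ℂ) ω M) (hχ : χ ∈ IsManifold.maximalAtlas 𝓘(ℂ) ω M)
    {a b : ℂ → E}
    (hab : ∀ w ∈ (φ.symm.trans χ).source,
      a w = ‖deriv (χ ∘ φ.symm) w‖ ^ 2 • b ((χ ∘ φ.symm) w))
    (ha : ∀ w ∈ φ.target, φ.symm w ∉ χ.source → a w = 0)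
    (hb : ∀ w ∈ χ.target, χ.symm w ∉ φ.source → b w = 0) :
    ∫ w in φ.target, a w = ∫ w in χ.target, b w := by
  have hτ : ∀ w ∈ (φ.symm.trans χ).source, DifferentiableAt ℂ (χ ∘ φ.symm) w := fun w hw =>
    (contDiffAt_transition hφ hχ hw).differentiableAt (by simp)
  calc ∫ w in φ.target, a w = ∫ w in (φ.symm.trans χ).source, a w :=
        setIntegral_eq_of_subset_of_forall_sdiff_eq_zero φ.open_target.measurableSet
          (fun w hw => hw.1) fun w hw => ha w hw.1 fun h => hw.2 ⟨hw.1, h⟩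
    _ = ∫ w in (φ.symm.trans χ).source,
          |(fderiv ℝ (χ ∘ φ.symm) w).det| • b ((χ ∘ φ.symm) w) := by
        refine setIntegral_congr_fun (φ.symm.trans χ).open_source.measurableSet fun w hw => ?_
        simp only [det_fderiv_real_eq_norm_deriv_sq (hτ w hw), abs_sq, hab w hw]
    _ = ∫ w in (φ.symm.trans χ) '' (φ.symm.trans χ).source, b w :=
        (integral_image_eq_integral_abs_det_fderiv_smul volume
          (φ.symm.trans χ).open_source.measurableSet (fun w hw =>
            ((hτ w hw).restrictScalars ℝ).hasFDerivAt.hasFDerivWithinAt)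
          (φ.symm.trans χ).injOn b).symm
    _ = ∫ w in (φ.symm.trans χ).target, b w := by
        rw [(φ.symm.trans χ).image_source_eq_target]
    _ = ∫ w in χ.target, b w :=
        Eq.symm <| setIntegral_eq_of_subset_of_forall_sdiff_eq_zero χ.open_target.measurableSet
          (fun w hw => hw.1) fun w hw => hb w hw.1 fun h => hw.2 ⟨hw.1, h⟩

theorem isContinuousTwoForm_iff : IsContinuousTwoForm c ↔
    (∀ φ ∈ IsManifold.maximalAtlas 𝓘(ℂ) ω M, ContinuousOn (c φ) φ.target) ∧
    ∀ φ ∈ IsManifold.maximalAtlas 𝓘(ℂ) ω M, ∀ χ ∈ IsManifold.maximalAtlas 𝓘(ℂ) ω M,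
      ∀ w ∈ (φ.symm.trans χ).source,
        c φ w = (‖deriv (χ ∘ φ.symm) w‖ : ℂ) ^ 2 * c χ ((χ ∘ φ.symm) w) := by
  refine ⟨fun hc => ⟨hc.continuousOn, fun φ hφ χ hχ w hw => ?_⟩, fun hc => ⟨hc.1, ?_⟩⟩
  · have htransform := hc.transform φ hφ χ hχ (φ.symm w) ⟨φ.map_target hw.1, hw.2⟩
    rwa [φ.right_inv hw.1] at htransform
  · intro φ hφ χ hχ p hp
    have hw : φ p ∈ (φ.symm.trans χ).source :=
      ⟨φ.map_source hp.1, by simpa [φ.left_inv hp.1] using hp.2⟩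
    simpa only [Function.comp_apply, φ.left_inv hp.1] using hc.2 φ hφ χ hχ _ hw

theorem IsConformalImmersion.isContinuousTwoForm_energyCoeff {f : M → Nil}
    (hf : IsConformalImmersion f) : IsContinuousTwoForm (M := M) (energyCoeff f) :=
  isContinuousTwoForm_iff.2 ⟨fun _ hφ => hf.continuousOn_energyCoeff hφ,
    fun _ hφ _ hχ _ hw => hf.energyCoeff_transition hφ hχ hw⟩

/-- The coefficients `G φ`, one for each holomorphic chart `φ`, define a smooth `(1,0)`-form
`G φ dz` on `M`. -/
structure IsSmoothOneForm (G : OpenPartialHomeomorph M ℂ → ℂ → ℂ) : Prop where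
  contDiffOn : ∀ φ ∈ IsManifold.maximalAtlas 𝓘(ℂ) ω M, ContDiffOn ℝ ∞ (G φ) φ.target
  transform : ∀ φ ∈ IsManifold.maximalAtlas 𝓘(ℂ) ω M,
    ∀ χ ∈ IsManifold.maximalAtlas 𝓘(ℂ) ω M, ∀ w ∈ (φ.symm.trans χ).source,
    G φ w = G χ ((χ ∘ φ.symm) w) * deriv (χ ∘ φ.symm) w

theorem IsConformalImmersion.isSmoothOneForm_zComp {f : M → Nil} (hf : IsConformalImmersion f)
    (k : Fin 3) : IsSmoothOneForm (M := M) fun φ w => zComp (f ∘ φ.symm) w k where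
  contDiffOn _ hφ _ hw :=
    ((hf.isConformalAt hφ hw).smooth.contDiffAt_zComp (by simp) k).contDiffWithinAt
  transform _ hφ _ hχ _ hw := hf.zComp_transition hφ hχ hw k

namespace IsSmoothOneForm

variable {G : OpenPartialHomeomorph M ℂ → ℂ → ℂ} (hG : IsSmoothOneForm G)
include hG

theorem contDiffAt (hφ : φ ∈ IsManifold.maximalAtlas 𝓘(ℂ) ω M) {w : ℂ} (hw : w ∈ φ.target) :
    ContDiffAt ℝ ∞ (G φ) w :=
  (hG.contDiffOn φ hφ).contDiffAt (φ.open_target.mem_nhds hw)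

theorem isContinuousTwoForm_dzbar : IsContinuousTwoForm (M := M) fun φ => dzbar (G φ) := by
  refine isContinuousTwoForm_iff.2 ⟨fun φ hφ w hw =>
    (contDiffAt_dzbar (m := 0) (hG.contDiffAt hφ hw)
      (by simp)).continuousAt.continuousWithinAt, fun φ hφ χ hχ w hw => ?_⟩
  have hopen := (φ.symm.trans χ).open_source
  have hτ : DifferentiableOn ℂ (χ ∘ φ.symm) (φ.symm.trans χ).source := fun u hu =>
    ((contDiffAt_transition hφ hχ hu).differentiableAt (by simp)).differentiableWithinAt
  have hτw : DifferentiableAt ℂ (χ ∘ φ.symm) w := hτ.differentiableAt (hopen.mem_nhds hw)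
  have hτ' : DifferentiableAt ℂ (deriv (χ ∘ φ.symm)) w :=
    (hτ.deriv hopen).differentiableAt (hopen.mem_nhds hw)
  have hGχ : DifferentiableAt ℝ (G χ) ((χ ∘ φ.symm) w) :=
    (hG.contDiffAt hχ (χ.map_source hw.2)).differentiableAt (by simp)
  rw [dzbar_congr (Filter.eventuallyEq_of_mem (hopen.mem_nhds hw) (hG.transform φ hφ χ hχ)),
    dzbar_mul (g := fun u => G χ ((χ ∘ φ.symm) u)) (hGχ.comp w (hτw.restrictScalars ℝ))
      (hτ'.restrictScalars ℝ),
    dzbar_eq_zero hτ', dzbar_comp_holomorphic hGχ hτw, ← Complex.mul_conj', Complex.star_def]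
  ring

theorem smul {σ : M → ℝ} (hσ : ContMDiff 𝓘(ℝ, ℂ) 𝓘(ℝ, ℝ) ∞ σ) :
    IsSmoothOneForm fun φ w => (σ (φ.symm w) : ℂ) * G φ w where
  contDiffOn φ hφ :=
    (Complex.ofRealCLM.contDiff.comp_contDiffOn
      (hσ.comp_contMDiffOn (contMDiffOn_symm_of_mem_maximalAtlas
        (mem_maximalAtlas_restrictScalars ℝ le_top hφ))).contDiffOn).mul (hG.contDiffOn φ hφ)
  transform φ hφ χ hχ w hw := by
    rw [hG.transform φ hφ χ hχ w hw, Function.comp_apply,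
      χ.left_inv (show φ.symm w ∈ χ.source from hw.2)]
    ring

end IsSmoothOneForm

variable [CompactSpace M] [T2Space M]

theorem tsupport_chartPartition_subset (p : M) :
    tsupport (chartPartition M p) ⊆ (chartAt ℂ p).source :=
  (exists_chartPartition M).choose_spec p

section SurfaceIntegral

variable {E : Type*} [NormedAddCommGroup E] [NormedSpace ℝ E]

theorem surfaceIntegral_eq_sum {t : Finset M} (ht : ∀ p ∉ t, chartPartition M p = 0)
    (c : OpenPartialHomeomorph M ℂ → ℂ → E) :
    surfaceIntegral (M := M) c = ∑ p ∈ t, ∫ w in (chartAt ℂ p).target,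
      chartPartition M p ((chartAt ℂ p).symm w) • c (chartAt ℂ p) w := by
  refine finsum_eq_sum_of_support_subset _ fun p hp => ?_
  by_contra hpt
  exact hp (by simp only [ht p hpt, ContinuousMap.zero_apply, zero_smul, integral_zero])

theorem surfaceIntegral_congr {c d : OpenPartialHomeomorph M ℂ → ℂ → E}
    (hcd : ∀ p : M, ∀ w ∈ (chartAt ℂ p).target, c (chartAt ℂ p) w = d (chartAt ℂ p) w) :
    surfaceIntegral (M := M) c = surfaceIntegral (M := M) d :=
  finsum_congr fun p => setIntegral_congr_fun (chartAt ℂ p).open_target.measurableSet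
    fun w hw => by simp only [hcd p w hw]

theorem integrableOn_chartPartition_smul {c : ℂ → E} {p : M}
    (hc : ContinuousOn c (chartAt ℂ p).target) :
    IntegrableOn (fun w => chartPartition M p ((chartAt ℂ p).symm w) • c w)
      (chartAt ℂ p).target := by
  refine integrableOn_target_of_eq_zero (isClosed_tsupport _) (tsupport_chartPartition_subset p)
    (((chartPartition M p).continuous.comp_continuousOn (chartAt ℂ p).continuousOn_symm).smul hc)
    fun w _ hw => ?_
  rw [image_eq_zero_of_notMem_tsupport hw, zero_smul]

theorem surfaceIntegral_clm_comp [CompleteSpace E] {E' : Type*} [NormedAddCommGroup E']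
    [NormedSpace ℝ E'] [CompleteSpace E'] (L : E →L[ℝ] E')
    {c : OpenPartialHomeomorph M ℂ → ℂ → E}
    (hc : ∀ p : M, ContinuousOn (c (chartAt ℂ p)) (chartAt ℂ p).target) :
    surfaceIntegral (M := M) (fun φ w => L (c φ w)) = L (surfaceIntegral (M := M) c) := by
  obtain ⟨t, ht, -⟩ := exists_finset_eq_zero_and_sum_eq_one (chartPartition M)
  simp only [surfaceIntegral_eq_sum ht, map_sum, ← map_smul]
  exact Finset.sum_congr rfl fun p _ =>
    L.integral_comp_comm (integrableOn_chartPartition_smul (hc p))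

theorem surfaceIntegral_finsetSum {ι : Type*} (s : Finset ι)
    {c : ι → OpenPartialHomeomorph M ℂ → ℂ → E}
    (hc : ∀ i ∈ s, ∀ p : M, ContinuousOn (c i (chartAt ℂ p)) (chartAt ℂ p).target) :
    surfaceIntegral (M := M) (fun φ w => ∑ i ∈ s, c i φ w) =
      ∑ i ∈ s, surfaceIntegral (M := M) (c i) := by
  obtain ⟨t, ht, -⟩ := exists_finset_eq_zero_and_sum_eq_one (chartPartition M)
  simp only [surfaceIntegral_eq_sum ht, Finset.smul_sum]
  rw [Finset.sum_comm]
  exact Finset.sum_congr rfl fun p _ =>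
    integral_finsetSum _ fun i hi => integrableOn_chartPartition_smul (hc i hi p)

end SurfaceIntegral

variable [IsManifold 𝓘(ℂ) ω M]

theorem IsContinuousTwoForm.surfaceIntegral_eq_setIntegral (hc : IsContinuousTwoForm (M := M) c)
    (hχ : χ ∈ IsManifold.maximalAtlas 𝓘(ℂ) ω M) {K : Set M} (hK : IsClosed K)
    (hKχ : K ⊆ χ.source)
    (hzero : ∀ φ ∈ IsManifold.maximalAtlas 𝓘(ℂ) ω M, ∀ w ∈ φ.target, φ.symm w ∉ K → c φ w = 0) :
    surfaceIntegral (M := M) c = ∫ w in χ.target, c χ w := by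
  obtain ⟨t, ht, hsum⟩ := exists_finset_eq_zero_and_sum_eq_one (chartPartition M)
  have hchart (p : M) : ∫ w in (chartAt ℂ p).target,
        chartPartition M p ((chartAt ℂ p).symm w) • c (chartAt ℂ p) w =
      ∫ w in χ.target, chartPartition M p (χ.symm w) • c χ w := by
    have hp := IsManifold.chart_mem_maximalAtlas (I := 𝓘(ℂ)) (n := ω) p
    refine setIntegral_target_eq hp hχ (fun w hw => ?_) (fun w hw hw' => ?_) fun w _ hw' => ?_
    · rw [(isContinuousTwoForm_iff.1 hc).2 _ hp χ hχ w hw, Function.comp_apply,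
        χ.left_inv (show (chartAt ℂ p).symm w ∈ χ.source from hw.2), smul_comm,
        Complex.real_smul (x := ‖_‖ ^ 2), Complex.ofReal_pow]
    · rw [hzero _ hp w hw fun h => hw' (hKχ h), smul_zero]
    · rw [image_eq_zero_of_notMem_tsupport (f := chartPartition M p)
        fun h => hw' (tsupport_chartPartition_subset p h), zero_smul]
  have hint (p : M) :
      IntegrableOn (fun w => chartPartition M p (χ.symm w) • c χ w) χ.target :=
    integrableOn_target_of_eq_zero hK hKχ
      (((chartPartition M p).continuous.comp_continuousOn χ.continuousOn_symm).smul
        (hc.continuousOn χ hχ)) fun w hw hwK => by rw [hzero χ hχ w hw hwK, smul_zero]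
  rw [surfaceIntegral_eq_sum ht, Finset.sum_congr rfl fun p _ => hchart p,
    ← integral_finsetSum _ fun p _ => hint p]
  simp only [← Finset.sum_smul, hsum, one_smul]

namespace IsSmoothOneForm

variable {G : OpenPartialHomeomorph M ℂ → ℂ → ℂ} (hG : IsSmoothOneForm G)
include hG

theorem surfaceIntegral_dzbar_eq_zero_of_subset_source
    (hχ : χ ∈ IsManifold.maximalAtlas 𝓘(ℂ) ω M) {K : Set M} (hK : IsClosed K)
    (hKχ : K ⊆ χ.source)
    (hzero : ∀ φ ∈ IsManifold.maximalAtlas 𝓘(ℂ) ω M, ∀ w ∈ φ.target, φ.symm w ∉ K → G φ w = 0) :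
    surfaceIntegral (M := M) (fun φ => dzbar (G φ)) = 0 := by
  have hdzbar : ∀ φ ∈ IsManifold.maximalAtlas 𝓘(ℂ) ω M, ∀ w ∈ φ.target, φ.symm w ∉ K →
      dzbar (G φ) w = 0 := by
    intro φ hφ w hw hwK
    have hev : G φ =ᶠ[nhds w] fun _ => 0 := by
      filter_upwards [φ.open_target.mem_nhds hw, (φ.continuousAt_symm hw).preimage_mem_nhds
        (hK.isOpen_compl.mem_nhds hwK)] with u hu huK using hzero φ hφ u hu huK
    rw [dzbar_congr hev, dzbar_eq_zero (differentiableAt_const 0)]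
  rw [hG.isContinuousTwoForm_dzbar.surfaceIntegral_eq_setIntegral hχ hK hKχ hdzbar]
  exact setIntegral_dzbar_eq_zero ((hG.contDiffOn χ hχ).of_le (by simp)) χ.open_target
    (hK.isCompact.image_of_continuousOn (χ.continuousOn.mono hKχ))
    (χ.mapsTo.mono_left hKχ).image_subset
    fun w hw => hzero χ hχ w hw.1 fun h => hw.2 ⟨_, h, χ.right_inv hw.1⟩

theorem surfaceIntegral_dzbar_eq_zero : surfaceIntegral (M := M) (fun φ => dzbar (G φ)) = 0 := by
  have := isManifold_restrictScalars ℝ ℂ ℂ M (m := ∞) (n := ω) le_top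
  have hatlas := IsManifold.chart_mem_maximalAtlas (M := M) (I := 𝓘(ℂ)) (n := ω)
  obtain ⟨σ, hσ⟩ := SmoothPartitionOfUnity.exists_isSubordinate 𝓘(ℝ, ℂ)
    (isClosed_univ (X := M)) (fun p : M => (chartAt ℂ p).source)
    (fun p => (chartAt ℂ p).open_source) fun p _ => Set.mem_iUnion.2 ⟨p, mem_chart_source ℂ p⟩
  obtain ⟨t, -, hsum⟩ := exists_finset_eq_zero_and_sum_eq_one σ.toPartitionOfUnity
  have hσG (q : M) : IsSmoothOneForm fun φ w => (σ q (φ.symm w) : ℂ) * G φ w :=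
    hG.smul (σ q).contMDiff
  calc surfaceIntegral (M := M) (fun φ => dzbar (G φ))
      = surfaceIntegral (M := M) (fun φ w => ∑ q ∈ t,
          dzbar (fun w => (σ q (φ.symm w) : ℂ) * G φ w) w) := by
        refine surfaceIntegral_congr fun p w hw => ?_
        have hdecomp : G (chartAt ℂ p) = fun w => ∑ q ∈ t,
            (σ q ((chartAt ℂ p).symm w) : ℂ) * G (chartAt ℂ p) w := by
          funext u
          have hone : ∑ q ∈ t, σ q ((chartAt ℂ p).symm u) = 1 := hsum _
          rw [← Finset.sum_mul, ← Complex.ofReal_sum, hone, Complex.ofReal_one, one_mul]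
        conv_lhs => rw [hdecomp]
        exact dzbar_sum fun q _ => ((hσG q).contDiffAt (hatlas p) hw).differentiableAt (by simp)
    _ = ∑ q ∈ t, surfaceIntegral (M := M)
          (fun φ => dzbar fun w => (σ q (φ.symm w) : ℂ) * G φ w) :=
        surfaceIntegral_finsetSum t fun q _ p =>
          (hσG q).isContinuousTwoForm_dzbar.continuousOn _ (hatlas p)
    _ = 0 := Finset.sum_eq_zero fun q _ =>
        (hσG q).surfaceIntegral_dzbar_eq_zero_of_subset_source (hatlas q) (isClosed_tsupport (σ q))
          (hσ q) fun φ _ w _ hw => by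
            rw [image_eq_zero_of_notMem_tsupport hw, Complex.ofReal_zero, zero_mul]

end IsSmoothOneForm

namespace IsConformalImmersion

variable {f : M → Nil} (hf : IsConformalImmersion f)
include hf

theorem im_spinorEnergy : (spinorEnergy f).im = 0 := by
  have hatlas := IsManifold.chart_mem_maximalAtlas (M := M) (I := 𝓘(ℂ)) (n := ω)
  have hZ := hf.isSmoothOneForm_zComp 2
  calc (spinorEnergy f).im
      = surfaceIntegral (M := M) (fun φ w => (energyCoeff f φ w).im) :=
        (surfaceIntegral_clm_comp Complex.imCLM
          fun p => hf.continuousOn_energyCoeff (hatlas p)).symm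
    _ = surfaceIntegral (M := M) (fun φ w =>
          ((1 / 2 : ℝ) • Complex.reCLM) (dzbar (fun u => zComp (f ∘ φ.symm) u 2) w)) :=
        surfaceIntegral_congr fun p w hw => by
          rw [hf.im_energyCoeff (hatlas p) hw, _root_.smul_apply, Complex.reCLM_apply,
            smul_eq_mul, one_div_mul_eq_div]
    _ = 0 := by
        rw [surfaceIntegral_clm_comp _ fun p =>
            hZ.isContinuousTwoForm_dzbar.continuousOn _ (hatlas p),
          hZ.surfaceIntegral_dzbar_eq_zero, map_zero]

theorem re_spinorEnergy : (spinorEnergy f).re = surfaceIntegral (M := M) fun φ w =>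
    meanCurvature (f ∘ φ.symm) w ^ 2 / 4 *
        (‖(spinorAt f φ w).1‖ ^ 2 + ‖(spinorAt f φ w).2‖ ^ 2) ^ 2 -
      1 / 16 * (‖(spinorAt f φ w).2‖ ^ 2 - ‖(spinorAt f φ w).1‖ ^ 2) ^ 2 := by
  have hatlas := IsManifold.chart_mem_maximalAtlas (M := M) (I := 𝓘(ℂ)) (n := ω)
  calc (spinorEnergy f).re
      = surfaceIntegral (M := M) (fun φ w => (energyCoeff f φ w).re) :=
        (surfaceIntegral_clm_comp Complex.reCLM
          fun p => hf.continuousOn_energyCoeff (hatlas p)).symm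
    _ = _ := surfaceIntegral_congr fun p w hw => hf.re_energyCoeff (hatlas p) hw

end IsConformalImmersion

end Surface

end

theorem mainTheorem7 {M : Type*} [TopologicalSpace M] [ChartedSpace ℂ M]
    [IsManifold 𝓘(ℂ) ω M] [CompactSpace M] [T2Space M]
    (f : M → Nil) (hf : IsConformalImmersion f) :
    (∀ φ ∈ IsManifold.maximalAtlas 𝓘(ℂ) ω M, ∀ w ∈ φ.target, ∃! c, IsEnergyCoeff f φ w c) ∧
    IsContinuousTwoForm (M := M) (energyCoeff f) ∧
    (spinorEnergy f).im = 0 ∧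
    spinorEnergy f =
      ((surfaceIntegral (M := M) fun φ w =>
        meanCurvature (f ∘ φ.symm) w ^ 2 / 4 *
            (‖(spinorAt f φ w).1‖ ^ 2 + ‖(spinorAt f φ w).2‖ ^ 2) ^ 2 -
          1 / 16 * (‖(spinorAt f φ w).2‖ ^ 2 - ‖(spinorAt f φ w).1‖ ^ 2) ^ 2 : ℝ) : ℂ) :=
  ⟨fun _ hφ _ hw => hf.existsUnique_isEnergyCoeff hφ hw, hf.isContinuousTwoForm_energyCoeff,
    hf.im_spinorEnergy, Complex.ext (by rw [hf.re_spinorEnergy, Complex.ofReal_re])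
      (by rw [hf.im_spinorEnergy, Complex.ofReal_im])⟩
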